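/- **Theorem 1 (Network disagreement).** Consider $K\ge 1$ agents. Agent $k$ has a set of tasks $\mathcal T_k$ with a probability distribution $\pi_k$; each task $t\in\mathcal T_k$ has a random data point $x_k^{(t)}$ and a loss $Q_k^{(t)}(w;x)$, twice differentiable in $w\in\mathbb R^M$. Put $J_k^{(t)}(w)=\mathbb E_{x}Q_k^{(t)}(w;x_k^{(t)})$ and $J_k(w)=\mathbb E_{t\sim\pi_k}J_k^{(t)}(w)$; for a batch $\mathcal X=\{x_1,\dots,x_N\}$ let $Q(w;\mathcal X)=\frac1N\sum_n Q(w;x_n)$. Vectors carry the Euclidean norm and matrices the spectral norm. Assume, with constants $L,\sigma_G,\sigma_H,\gamma_G,\gamma_H\ge 0$ and $\rho,B$, that for all $k$, $t\in\mathcal T_k$ and $w,u\in\mathbb R^M$: 1. $\|\nabla Q_k^{(t)}(w;x)-\nabla Q_k^{(t)}(u;x)\|\le L^{x}\|w-u\|$ for a data-dependent $L^x$ with $\mathbb E (L^{x})^2\le L^2$; 2. $\mathbb E\|\nabla^2Q_k^{(t)}(w;x)-\nabla^2Q_k^{(t)}(u;x)\|\le\rho\|w-u\|$; 3. $\mathbb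 E\|\nabla Q_k^{(t)}(w;x)\|\le B$; 4. $\mathbb E\|\nabla Q_k^{(t)}(w;x)-\nabla J_k^{(t)}(w)\|^4\le\sigma_G^4$ and $\mathbb E\|\nabla^2 Q_k^{(t)}(w;x)-\nabla^2 J_k^{(t)}(w)\|^4\le\sigma_H^4$; 5. $\mathbb E_{t\sim\pi_k}\|\nabla J_k^{(t)}(w)-\nabla J_k(w)\|^4\le\gamma_G^4$ and $\mathbb E_{t\sim\pi_k}\|\nabla^2 J_k^{(t)}(w)-\nabla^2 J_k(w)\|^4\le\gamma_H^4$; 6. $A=[a_{\ell k}]\in\mathbb R^{K\times K}$ is doubly stochastic and primitive. Let $\alpha>0$. For $\mu>0$ and deterministic initial models $w_{k,0}$, the Dif-MAML iterates are $$w_{k,i}=\sum_{\ell=1}^K a_{\ell k}\bigl(w_{\ell,i-1}-\mu\,\nabla\overline{Q_\ell}(w_{\ell,i-1})\bigr),$$ $$\nabla\overline{Q_k}(w)=\frac1{|\mathcal S_k|}\sum_{t\in\mathcal S_k}\bigl(I-\alpha\nabla^2Q_k^{(t)}(w;\mathcal X_{in}^{(t)})\bigr)\nabla Q_k^{(t)}\bigl(w-\alpha\nabla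 Q_k^{(t)}(w;\mathcal X_{in}^{(t)});\mathcal X_o^{(t)}\bigr),$$ where at every iteration agent $k$ draws a fresh batch $\mathcal S_k$ of $|\mathcal S_k|\ge1$ i.i.d. tasks from $\pi_k$ and, for each of them, independent batches $\mathcal X_{in}^{(t)},\mathcal X_o^{(t)}$ of $|\mathcal X_{in}|\ge1$ and $|\mathcal X_o|\ge1$ i.i.d. data points, and the samples at different iterations are independent. Let $w_{c,i}=\frac1K\sum_k w_{k,i}$. Let $\lambda_2=\|A^{\mathsf T}-\frac1K\mathbf 1\mathbf 1^{\mathsf T}\|$ (spectral norm), $\widehat B=(1+\alpha L)B$ and $C^2=\max_k\frac{3}{|\mathcal S_k|}(C_1^2+C_2^2+C_3^2)$, where $$C_1^2=6(1+\alpha L)^2\sigma_G^2\Bigl(\tfrac1{|\mathcal X_o|}+\tfrac{L^2\alpha^2}{|\mathcal X_{in}|}\Bigr)+\tfrac{6\alpha^2\sigma_H^2}{|\mathcal X_{in}|}\Bigl(B^2+\tfrac{\sigma_G^2}{|\mathcal X_o|}\Bigr)+\tfrac{9\alpha^4}{|\mathcal X_{in}|^2}(\sigma_H^4+L^4\sigma_G^4),$$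 $$C_2^2=8(1+\alpha L)^2(1+\alpha^2L^2)\gamma_G^2+4B^2\alpha^2\gamma_H^2+2\alpha^4\gamma_H^4+16(1+\alpha^4L^4)\gamma_G^4,$$ $$C_3=(1+\alpha L)\alpha L\tfrac{\sigma_G}{\sqrt{|\mathcal X_{in}|}}+(1+\alpha L)^2\gamma_G+B\alpha\tfrac{\sigma_H}{\sqrt{|\mathcal X_{in}|}}+B\alpha\gamma_H+\tfrac{\alpha^2\sigma_H^2}{|\mathcal X_{in}|}+\alpha^2\gamma_H^2+\tfrac{\alpha^2L^2\sigma_G^2}{|\mathcal X_{in}|}+2(1+\alpha^2L^2)\gamma_G^2.$$ Then the spectral radius of $A^{\mathsf T}-\frac1K\mathbf 1\mathbf 1^{\mathsf T}$ is smaller than $1$, and $\lambda_2$ equals this spectral radius (hence $\lambda_2<1$) whenever $A$ is normal, in particular whenever $A$ is symmetric. If $\lambda_2<1$, then for all $\mu>0$ and $i\ge0$ $$\frac1K\sum_{k=1}^K\mathbb E\|w_{k,i}-w_{c,i}\|^2\le\lambda_2^i\,\frac1K\sum_{k=1}^K\|w_{k,0}-w_{c,0}\|^2+\mu^2\frac{\lambda_2^2}{(1-\lambda_2)^2}(\widehat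 B^2+C^2),$$ and there are constants $c,D$, independent of $\mu$ and $i$, such that $$\frac1K\sum_{k=1}^K\mathbb E\|w_{k,i}-w_{c,i}\|^2\le\mu^2\frac{\lambda_2^2}{(1-\lambda_2)^2}(\widehat B^2+C^2)+c\,\mu^3\qquad\text{whenever } i\ge\frac{3\log\mu}{\log\lambda_2}+D,$$ where, as $\mu\to0^+$, the threshold $\frac{3\log\mu}{\log\lambda_2}+D$ is $O(\log\mu)$ and $o(1/\mu)$ (for $\lambda_2=0$ the quotient $\frac{3\log\mu}{\log\lambda_2}$ is read as $0$). -/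

import Mathlib

open MeasureTheory ProbabilityTheory Filter Topology
open scoped Matrix

universe u v w

namespace DifMAML

/-- The parameter space `ℝ^M` with the Euclidean norm. -/
abbrev Param (M : ℕ) : Type := EuclideanSpace ℝ (Fin M)

/-- The Hessian of a scalar function, as a continuous linear operator; its norm is the
operator (spectral) norm. -/
noncomputable def hessian {M : ℕ} (f : Param M → ℝ) (p : Param M) : Param M →L[ℝ] Param M :=
  fderiv ℝ (gradient f) p

/-- The data of one agent: a space of tasks with the distribution of the tasks, the
distribution of a data point of each task, and the loss of a parameter vector at a data point
of a task. -/
structure Agent (M : ℕ) where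
  Task : Type u
  Data : Type v
  [measurableSpaceTask : MeasurableSpace Task]
  [measurableSpaceData : MeasurableSpace Data]
  taskLaw : Measure Task
  [isProbabilityMeasure_taskLaw : IsProbabilityMeasure taskLaw]
  dataLaw : Kernel Task Data
  [isMarkovKernel_dataLaw : IsMarkovKernel dataLaw]
  loss : Task → Param M → Data → ℝ

attribute [instance] Agent.measurableSpaceTask Agent.measurableSpaceData
  Agent.isProbabilityMeasure_taskLaw Agent.isMarkovKernel_dataLaw

namespace Agent

variable {M : ℕ}

/-- The stochastic risk of a task: the expected loss over the data of the task. -/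
noncomputable def risk (a : Agent.{u, v} M) (t : a.Task) (p : Param M) : ℝ :=
  ∫ x, a.loss t p x ∂(a.dataLaw t)

/-- The mean of the risks over the task distribution. -/
noncomputable def meanRisk (a : Agent.{u, v} M) (p : Param M) : ℝ :=
  ∫ t, a.risk t p ∂a.taskLaw

/-- The loss on a batch: the average of the losses of its data points. -/
noncomputable def batchLoss (a : Agent.{u, v} M) {N : ℕ} (t : a.Task) (χ : Fin N → a.Data)
    (p : Param M) : ℝ :=
  (1 / (N : ℝ)) * ∑ n, a.loss t p (χ n)

/-- What the problem setting takes for granted: the loss is measurable, twice differentiable in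
the parameter, and the expectations that define the risks exist. -/
structure Regular (a : Agent.{u, v} M) : Prop where
  measurable_loss : Measurable fun q : a.Task × Param M × a.Data => a.loss q.1 q.2.1 q.2.2
  differentiable_loss : ∀ t x, Differentiable ℝ fun p => a.loss t p x
  differentiable_gradient : ∀ t x, Differentiable ℝ (gradient fun p => a.loss t p x)
  integrable_loss : ∀ t p, Integrable (a.loss t p) (a.dataLaw t)
  integrable_risk : ∀ p, Integrable (fun t => a.risk t p) a.taskLaw

/-- Lipschitz gradients, with a data-dependent Lipschitz constant whose second-order moment is
bounded. -/
def LipschitzGradients (a : Agent.{u, v} M) (L : ℝ) : Prop :=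
  ∀ t, ∃ ℓ : a.Data → ℝ, MemLp ℓ 2 (a.dataLaw t) ∧
    (∀ᵐ x ∂(a.dataLaw t), ∀ p q : Param M,
      ‖gradient (fun y => a.loss t y x) p - gradient (fun y => a.loss t y x) q‖
        ≤ ℓ x * ‖p - q‖) ∧
    ∫ x, ℓ x ^ 2 ∂(a.dataLaw t) ≤ L ^ 2

/-- Hessians that are Lipschitz in expectation. -/
def LipschitzHessians (a : Agent.{u, v} M) (ρ : ℝ) : Prop :=
  ∀ t, ∀ p q : Param M,
    Integrable (fun x => ‖hessian (fun y => a.loss t y x) p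
      - hessian (fun y => a.loss t y x) q‖) (a.dataLaw t) ∧
    ∫ x, ‖hessian (fun y => a.loss t y x) p - hessian (fun y => a.loss t y x) q‖
      ∂(a.dataLaw t) ≤ ρ * ‖p - q‖

/-- Gradients that are bounded in expectation. -/
def BoundedGradients (a : Agent.{u, v} M) (B : ℝ) : Prop :=
  ∀ t, ∀ p : Param M,
    Integrable (fun x => ‖gradient (fun y => a.loss t y x) p‖) (a.dataLaw t) ∧
    ∫ x, ‖gradient (fun y => a.loss t y x) p‖ ∂(a.dataLaw t) ≤ B

/-- Bounded fourth-order central moments of the gradient and the Hessian of the loss, with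
respect to the data. -/
def BoundedNoiseMoments (a : Agent.{u, v} M) (σG σH : ℝ) : Prop :=
  ∀ t, ∀ p : Param M,
    (Integrable (fun x => ‖gradient (fun y => a.loss t y x) p - gradient (a.risk t) p‖ ^ 4)
        (a.dataLaw t) ∧
      ∫ x, ‖gradient (fun y => a.loss t y x) p - gradient (a.risk t) p‖ ^ 4 ∂(a.dataLaw t)
        ≤ σG ^ 4) ∧
    (Integrable (fun x => ‖hessian (fun y => a.loss t y x) p - hessian (a.risk t) p‖ ^ 4)
        (a.dataLaw t) ∧
      ∫ x, ‖hessian (fun y => a.loss t y x) p - hessian (a.risk t) p‖ ^ 4 ∂(a.dataLaw t)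
        ≤ σH ^ 4)

/-- Bounded fourth-order central moments of the gradient and the Hessian of the risks, with
respect to the tasks. -/
def BoundedTaskVariability (a : Agent.{u, v} M) (γG γH : ℝ) : Prop :=
  ∀ p : Param M,
    (Integrable (fun t => ‖gradient (a.risk t) p - gradient a.meanRisk p‖ ^ 4) a.taskLaw ∧
      ∫ t, ‖gradient (a.risk t) p - gradient a.meanRisk p‖ ^ 4 ∂a.taskLaw ≤ γG ^ 4) ∧
    (Integrable (fun t => ‖hessian (a.risk t) p - hessian a.meanRisk p‖ ^ 4) a.taskLaw ∧
      ∫ t, ‖hessian (a.risk t) p - hessian a.meanRisk p‖ ^ 4 ∂a.taskLaw ≤ γH ^ 4)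

/-- One sampled task together with an inner and an outer batch of data. -/
abbrev Sample (a : Agent.{u, v} M) (Nin Nout : ℕ) : Type (max u v) :=
  a.Task × (Fin Nin → a.Data) × (Fin Nout → a.Data)

theorem measurable_pi_dataLaw (a : Agent.{u, v} M) (N : ℕ) :
    Measurable fun t => Measure.pi fun _ : Fin N => a.dataLaw t := by
  apply Measurable.measure_of_isPiSystem_of_isProbabilityMeasure generateFrom_pi.symm isPiSystem_pi
  rintro _ ⟨s, hs, rfl⟩
  simp only [Measure.pi_pi]
  exact Finset.measurable_prod _ fun n _ => a.dataLaw.measurable_coe (hs n (Set.mem_univ n))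

/-- The law of a batch of `N` independent data points of a task. -/
noncomputable def batchLaw (a : Agent.{u, v} M) (N : ℕ) : Kernel a.Task (Fin N → a.Data) where
  toFun t := Measure.pi fun _ : Fin N => a.dataLaw t
  measurable' := a.measurable_pi_dataLaw N

instance (a : Agent.{u, v} M) (N : ℕ) : IsMarkovKernel (a.batchLaw N) :=
  ⟨fun t => inferInstanceAs (IsProbabilityMeasure (Measure.pi fun _ : Fin N => a.dataLaw t))⟩

/-- The law of a sample: the task is drawn from the task distribution and, given the task, the
two batches consist of independent data points of that task. -/
noncomputable def sampleLaw (a : Agent.{u, v} M) (Nin Nout : ℕ) :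
    Measure (a.Sample Nin Nout) :=
  a.taskLaw ⊗ₘ (a.batchLaw Nin ×ₖ a.batchLaw Nout)

/-- The MAML gradient of one sample,
`(I - α ∇²Q(p; χ_in)) ∇Q(p - α ∇Q(p; χ_in); χ_out)`. -/
noncomputable def sampleMetaGradient (a : Agent.{u, v} M) {Nin Nout : ℕ} (α : ℝ)
    (s : a.Sample Nin Nout) (p : Param M) : Param M :=
  (ContinuousLinearMap.id ℝ (Param M) - α • hessian (a.batchLoss s.1 s.2.1) p)
    (gradient (a.batchLoss s.1 s.2.2) (p - α • gradient (a.batchLoss s.1 s.2.1) p))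

/-- The stochastic MAML gradient: the average over a batch of `S` sampled tasks. -/
noncomputable def stochasticMetaGradient (a : Agent.{u, v} M) {Nin Nout S : ℕ} (α : ℝ)
    (s : Fin S → a.Sample Nin Nout) (p : Param M) : Param M :=
  (1 / (S : ℝ)) • ∑ j, a.sampleMetaGradient α (s j) p

end Agent

section Network

variable {K M : ℕ}

/-- The Dif-MAML iterates (adapt, then combine) along one realization of the samples; `ξ i` is
the collection of the samples that all agents use in the step from time `i` to `i + 1`. -/
noncomputable def iterates (agent : Fin K → Agent.{u, v} M) {Nin Nout : ℕ} {S : Fin K → ℕ}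
    (A : Matrix (Fin K) (Fin K) ℝ) (α μ : ℝ) (w₀ : Fin K → Param M)
    (ξ : ℕ → ∀ k, Fin (S k) → (agent k).Sample Nin Nout) : ℕ → Fin K → Param M
  | 0 => w₀
  | i + 1 => fun k => ∑ l, A l k •
      (iterates agent A α μ w₀ ξ i l
        - μ • (agent l).stochasticMetaGradient α (ξ i l) (iterates agent A α μ w₀ ξ i l))

/-- The centroid of the parameters of the agents. -/
noncomputable def centroid (p : Fin K → Param M) : Param M :=
  (1 / (K : ℝ)) • ∑ k, p k

/-- The sampling of the algorithm: at each time, the tasks of an agent are drawn independently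
from its task distribution, with independent batches of data, and the samples at different
times are independent. Nothing is assumed about the dependence between different agents at the
same time. -/
structure IsSampling {Ω : Type w} [MeasurableSpace Ω] (P : Measure Ω)
    (agent : Fin K → Agent.{u, v} M) (Nin Nout : ℕ) (S : Fin K → ℕ)
    (ξ : ℕ → Ω → ∀ k, Fin (S k) → (agent k).Sample Nin Nout) : Prop where
  measurable : ∀ i, Measurable (ξ i)
  law : ∀ i k, P.map (fun ω => ξ i ω k)
    = Measure.pi fun _ : Fin (S k) => (agent k).sampleLaw Nin Nout
  indep : iIndepFun ξ P

/-- The matrix `Aᵀ - (1/K) 1 1ᵀ`. -/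
noncomputable def deviationMatrix (A : Matrix (Fin K) (Fin K) ℝ) : Matrix (Fin K) (Fin K) ℝ :=
  Aᵀ - Matrix.of fun _ _ => 1 / (K : ℝ)

/-- The (complex) spectral radius of `Aᵀ - (1/K) 1 1ᵀ`. -/
noncomputable def deviationSpectralRadius (A : Matrix (Fin K) (Fin K) ℝ) : ℝ :=
  (spectralRadius ℂ ((deviationMatrix A).map (algebraMap ℝ ℂ))).toReal

/-- The mixing rate `‖Aᵀ - (1/K) 1 1ᵀ‖` in the spectral norm, that is, the operator norm with
respect to the Euclidean norm. -/
noncomputable def mixingRate (A : Matrix (Fin K) (Fin K) ℝ) : ℝ :=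
  ‖Matrix.toEuclideanCLM (n := Fin K) (𝕜 := ℝ) (deviationMatrix A)‖

end Network

/-- The bound `B̂` on the gradient of the adjusted objective. -/
noncomputable def Bhat (α L B : ℝ) : ℝ := (1 + α * L) * B

/-- The constant `C₁²` of the gradient-noise bound. -/
noncomputable def C1sq (α L B σG σH : ℝ) (Nin Nout : ℕ) : ℝ :=
  6 * (1 + α * L) ^ 2 * σG ^ 2 * (1 / (Nout : ℝ) + L ^ 2 * α ^ 2 / (Nin : ℝ))
    + 6 * α ^ 2 * σH ^ 2 / (Nin : ℝ) * (B ^ 2 + σG ^ 2 / (Nout : ℝ))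
    + 9 * α ^ 4 / (Nin : ℝ) ^ 2 * (σH ^ 4 + L ^ 4 * σG ^ 4)

/-- The constant `C₂²` of the gradient-noise bound. -/
noncomputable def C2sq (α L B γG γH : ℝ) : ℝ :=
  8 * (1 + α * L) ^ 2 * (1 + α ^ 2 * L ^ 2) * γG ^ 2 + 4 * B ^ 2 * α ^ 2 * γH ^ 2
    + 2 * α ^ 4 * γH ^ 4 + 16 * (1 + α ^ 4 * L ^ 4) * γG ^ 4

/-- The constant `C₃` of the gradient-noise bound. -/
noncomputable def C3 (α L B σG σH γG γH : ℝ) (Nin : ℕ) : ℝ :=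
  (1 + α * L) * α * L * (σG / √(Nin : ℝ)) + (1 + α * L) ^ 2 * γG
    + B * α * (σH / √(Nin : ℝ)) + B * α * γH + α ^ 2 * (σH ^ 2 / (Nin : ℝ)) + α ^ 2 * γH ^ 2
    + α ^ 2 * L ^ 2 * (σG ^ 2 / (Nin : ℝ)) + 2 * (1 + α ^ 2 * L ^ 2) * γG ^ 2

/-- The gradient-noise bound `C²`; the agents may use task batches of different sizes `S k`, and
the largest of the resulting constants is taken. -/
noncomputable def Csq {K : ℕ} (α L B σG σH γG γH : ℝ) (Nin Nout : ℕ) (S : Fin K → ℕ) : ℝ :=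
  ⨆ k : Fin K, 3 / (S k : ℝ) *
    (C1sq α L B σG σH Nin Nout + C2sq α L B γG γH + C3 α L B σG σH γG γH Nin ^ 2)

end DifMAML

/-! The disagreement after a combination step is `V = Aᵀ - (1/K) 1 1ᵀ` applied to the old
disagreement minus `μ` times the stochastic gradients, since `A` preserves the mean and `V` kills
constant vectors (`combine_sub_centroid`). It therefore shrinks by `λ₂ = ‖V‖`. Convexity of the
square with weights `λ₂` and `1 - λ₂` separates the two contributions without any independence
between agents, and gives `D (i+1) ≤ λ₂ D i + μ² λ₂² / (1 - λ₂) G` for the mean square disagreement,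
where `G` bounds the second moment of the stochastic gradient at every fixed parameter. That bound
passes to the random iterate because the iterate is a function of past samples only
(`IsSampling.indepFun_iterates`). The geometric recursion yields the linear rate
(`IsSampling.disagreement_recursion`), and once `λ₂ ^ i ≤ μ³` the transient is a term `c μ³`.

The analytic core is the admissibility of `G = B̂² + C²`. An average of `S` independent sampled
gradients has second moment at most the squared norm of the mean plus `1/S` times the second moment
about any point (`integral_norm_average_sq_pi_le`). The mean has norm at most `B̂`. With the exact
MAML gradient of the mean risk as the point, the error splits into outer-batch noise, displacement
of the inner step, Hessian noise of the inner batch, and task variability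
(`norm_sampleMetaGradient_sub_sq_le`, `exists_metaGradient_variability_bound`). The bias of the
sampled gradient is never estimated, so the `C3` part of `C²` is mere slack.

The delicate term is the displacement: Hessian and gradient noise of the same inner batch are
multiplied there, and they are dependent. Young's inequality reduces the product to fourth moments
of batch averages, which are of order `N⁻²`. Averaging estimates use an inner product, which the
operator norm lacks; Hessians thus enter only through the scalar average of their norms or through
their values at a fixed vector.

For the spectral radius, an eigenvector of `V` with nonzero eigenvalue has zero sum, so it is an
eigenvector of `Aᵀ`, and a positive power of `A` contracts such vectors strictly. For normal `A` the
matrix `V` is normal, and its norm is its spectral radius. -/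

namespace DifMAML

/-! ### Spectral radius and norm of the deviation matrix -/

section Spectral

variable {K : ℕ}

theorem sum_deviationMatrix_mulVec (hK : 0 < K) {A : Matrix (Fin K) (Fin K) ℝ}
    (hA : A ∈ doublyStochastic ℝ (Fin K)) (x : Fin K → ℂ) :
    ∑ i, ((deviationMatrix A).map (algebraMap ℝ ℂ) *ᵥ x) i = 0 := by
  simp only [Matrix.mulVec, dotProduct]
  rw [Finset.sum_comm]
  refine Finset.sum_eq_zero fun j _ => ?_
  rw [← Finset.sum_mul]
  have h : ∑ i, deviationMatrix A i j = 0 := by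
    simp only [deviationMatrix, Matrix.sub_apply, Matrix.transpose_apply, Matrix.of_apply,
      Finset.sum_sub_distrib, sum_row_of_mem_doublyStochastic hA]
    simp [hK.ne']
  have h' : ∑ i, (deviationMatrix A).map (algebraMap ℝ ℂ) i j = 0 := by
    simp only [Matrix.map_apply, ← map_sum, h, map_zero]
  rw [h', zero_mul]

theorem transpose_mulVec_eq_of_sum_eq_zero (A : Matrix (Fin K) (Fin K) ℝ) {x : Fin K → ℂ}
    (hx : ∑ i, x i = 0) :
    (A.map (algebraMap ℝ ℂ))ᵀ *ᵥ x = (deviationMatrix A).map (algebraMap ℝ ℂ) *ᵥ x := by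
  ext i
  simp only [Matrix.mulVec, dotProduct, Matrix.map_apply, Matrix.transpose_apply,
    deviationMatrix, Matrix.sub_apply, Matrix.of_apply, map_sub, sub_mul, Finset.sum_sub_distrib]
  rw [← Finset.mul_sum, hx]
  simp

theorem pow_transpose_mulVec_of_eigenvector (A : Matrix (Fin K) (Fin K) ℝ) {x : Fin K → ℂ} {ν : ℂ}
    (h : (A.map (algebraMap ℝ ℂ))ᵀ *ᵥ x = ν • x) (m : ℕ) :
    ((A ^ m).map (algebraMap ℝ ℂ))ᵀ *ᵥ x = ν ^ m • x := by
  have h1 : ∀ m : ℕ, ((A ^ m).map (algebraMap ℝ ℂ))ᵀ = ((A.map (algebraMap ℝ ℂ))ᵀ) ^ m := by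
    intro m
    rw [Matrix.map_pow, Matrix.transpose_pow]
  rw [h1]
  induction m with
  | zero => simp
  | succ n ih => rw [pow_succ, ← Matrix.mulVec_mulVec, h, Matrix.mulVec_smul, ih, smul_smul, pow_succ,
      mul_comm]

/-- A vector of zero sum does not see a constant added to all entries, so `ε` may be subtracted
everywhere. What remains is nonnegative with column sums `1 - K * ε`, and this bounds the action of
the transpose in the sup norm. -/
theorem norm_le_of_positive_columns (hK : 0 < K) {P : Matrix (Fin K) (Fin K) ℝ} {ε : ℝ}
    (hP : ∀ i j, ε ≤ P i j) (hcol : ∀ j, ∑ i, P i j = 1) {x : Fin K → ℂ} (hx0 : x ≠ 0)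
    (hx : ∑ i, x i = 0) {ν : ℂ} (h : (P.map (algebraMap ℝ ℂ))ᵀ *ᵥ x = ν • x) :
    ‖ν‖ ≤ 1 - K * ε := by
  have hxpos : 0 < ‖x‖ := norm_pos_iff.2 hx0
  have hq : 0 ≤ 1 - K * ε := by
    have := Finset.sum_nonneg fun i (_ : i ∈ Finset.univ) => sub_nonneg.2 (hP i ⟨0, hK⟩)
    simpa [Finset.sum_sub_distrib, hcol] using this
  refine le_of_mul_le_mul_right ?_ hxpos
  rw [← norm_smul, ← h]
  refine (pi_norm_le_iff_of_nonneg (by positivity)).2 fun i => ?_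
  have h2 : ((P.map (algebraMap ℝ ℂ))ᵀ *ᵥ x) i = ∑ j, ((P j i - ε : ℝ) : ℂ) * x j := by
    simp only [Matrix.mulVec, dotProduct, Matrix.map_apply, Matrix.transpose_apply,
      Complex.ofReal_sub, sub_mul, Finset.sum_sub_distrib, ← Finset.mul_sum, hx]
    simp
  rw [h2]
  refine (norm_sum_le _ _).trans ?_
  have h3 : ∀ j ∈ Finset.univ, ‖((P j i - ε : ℝ) : ℂ) * x j‖ ≤ (P j i - ε) * ‖x‖ := by
    intro j _
    rw [norm_mul, Complex.norm_real, Real.norm_of_nonneg (sub_nonneg.2 (hP j i))]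
    exact mul_le_mul_of_nonneg_left (norm_le_pi_norm x j) (sub_nonneg.2 (hP j i))
  refine (Finset.sum_le_sum h3).trans (le_of_eq ?_)
  rw [← Finset.sum_mul, Finset.sum_sub_distrib, hcol]
  simp

theorem deviationSpectralRadius_lt_one (hK : 0 < K) {A : Matrix (Fin K) (Fin K) ℝ}
    (hA : A ∈ doublyStochastic ℝ (Fin K)) (hPrim : A.IsPrimitive) :
    deviationSpectralRadius A < 1 := by
  obtain ⟨m, hm, hpos⟩ := hPrim.exists_pos_pow
  have : Nonempty (Fin K) := ⟨⟨0, hK⟩⟩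
  obtain ⟨⟨a, b⟩, hab⟩ := Finite.exists_min fun p : Fin K × Fin K => (A ^ m) p.1 p.2
  have hAm : A ^ m ∈ doublyStochastic ℝ (Fin K) := pow_mem hA m
  set ε := (A ^ m) a b with hε
  have hcol : ∀ j, ∑ i, (A ^ m) i j = 1 := sum_col_of_mem_doublyStochastic hAm
  have hε0 : 0 < ε := hpos a b
  have hq : 0 ≤ 1 - K * ε := by
    have := Finset.sum_nonneg fun i (_ : i ∈ Finset.univ) => sub_nonneg.2 (hab (i, b))
    simpa [Finset.sum_sub_distrib, hcol] using this
  have hq1 : 1 - K * ε < 1 := by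
    have : (0 : ℝ) < K := by exact_mod_cast hK
    nlinarith
  -- Only the `m`-th power is known to contract, by the factor `1 - K * ε`; eigenvalues of `A`
  -- itself are bounded by the `m`-th root.
  set r := (1 - K * ε) ^ (1 / (m : ℝ)) with hr
  have hr0 : 0 ≤ r := Real.rpow_nonneg hq _
  have hr1 : r < 1 := Real.rpow_lt_one hq hq1 (by positivity)
  have hrm : r ^ m = 1 - K * ε := by
    rw [hr, one_div, Real.rpow_inv_natCast_pow hq hm.ne']
  have hbound : spectralRadius ℂ ((deviationMatrix A).map (algebraMap ℝ ℂ)) ≤ ENNReal.ofReal r := by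
    refine iSup₂_le fun ν hν => ?_
    have hν' : ‖ν‖ ≤ r := by
      -- The zero sum of an eigenvector comes from dividing by its eigenvalue, so the eigenvalue `0`
      -- is set apart.
      rcases eq_or_ne ν 0 with rfl | hν0
      · simpa using hr0
      rw [← Matrix.spectrum_toLin', ← Module.End.hasEigenvalue_iff_mem_spectrum] at hν
      obtain ⟨x, hx⟩ := hν.exists_hasEigenvector
      have hxe := hx.apply_eq_smul
      rw [Matrix.toLin'_apply] at hxe
      have hsum : ∑ i, x i = 0 := by
        have h1 := sum_deviationMatrix_mulVec hK hA x
        rw [hxe] at h1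
        simp only [Pi.smul_apply, ← Finset.smul_sum] at h1
        exact (smul_eq_zero.1 h1).resolve_left hν0
      have h2 := pow_transpose_mulVec_of_eigenvector A
        ((transpose_mulVec_eq_of_sum_eq_zero A hsum).trans hxe) m
      have h3 := norm_le_of_positive_columns hK (fun i j => hab (i, j)) hcol hx.2 hsum h2
      rw [norm_pow] at h3
      exact (pow_le_pow_iff_left₀ (norm_nonneg _) hr0 hm.ne').1 (h3.trans hrm.ge)
    rw [← ENNReal.ofReal_coe_nnreal]
    exact ENNReal.ofReal_le_ofReal hν'
  calc deviationSpectralRadius A ≤ (ENNReal.ofReal r).toReal :=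
        ENNReal.toReal_mono ENNReal.ofReal_ne_top hbound
    _ = r := ENNReal.toReal_ofReal hr0
    _ < 1 := hr1

/-- The spectral radius lives over `ℂ` while the mixing rate is a real norm. A real matrix acts
separately on real and imaginary parts, whose squared norms add up, so complexification does not
change the norm. -/
theorem norm_toEuclideanCLM_ofReal (V : Matrix (Fin K) (Fin K) ℝ) :
    ‖Matrix.toEuclideanCLM (n := Fin K) (𝕜 := ℂ) (V.map (algebraMap ℝ ℂ))‖
      = ‖Matrix.toEuclideanCLM (n := Fin K) (𝕜 := ℝ) V‖ := by
  apply le_antisymm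
  · refine ContinuousLinearMap.opNorm_le_bound _ (norm_nonneg _) fun z => ?_
    set x : EuclideanSpace ℝ (Fin K) := WithLp.toLp 2 fun i => (z i).re with hx
    set y : EuclideanSpace ℝ (Fin K) := WithLp.toLp 2 fun i => (z i).im with hy
    have hz : ‖z‖ ^ 2 = ‖x‖ ^ 2 + ‖y‖ ^ 2 := by
      rw [EuclideanSpace.norm_sq_eq, EuclideanSpace.norm_sq_eq, EuclideanSpace.norm_sq_eq,
        ← Finset.sum_add_distrib]
      refine Finset.sum_congr rfl fun i _ => ?_
      rw [Complex.sq_norm, Complex.normSq_apply]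
      simp [hx, hy, sq]
    have hVz : ‖Matrix.toEuclideanCLM (n := Fin K) (𝕜 := ℂ) (V.map (algebraMap ℝ ℂ)) z‖ ^ 2
        = ‖Matrix.toEuclideanCLM (n := Fin K) (𝕜 := ℝ) V x‖ ^ 2
          + ‖Matrix.toEuclideanCLM (n := Fin K) (𝕜 := ℝ) V y‖ ^ 2 := by
      rw [EuclideanSpace.norm_sq_eq, EuclideanSpace.norm_sq_eq, EuclideanSpace.norm_sq_eq,
        ← Finset.sum_add_distrib]
      refine Finset.sum_congr rfl fun i _ => ?_
      rw [Complex.sq_norm, Complex.normSq_apply]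
      simp [hx, hy, sq, Matrix.ofLp_toEuclideanCLM, Matrix.mulVec, dotProduct]
    refine le_of_sq_le_sq ?_ (by positivity)
    rw [hVz, mul_pow, hz, mul_add, ← mul_pow, ← mul_pow]
    gcongr <;> exact ContinuousLinearMap.le_opNorm _ _
  · refine ContinuousLinearMap.opNorm_le_bound _ (norm_nonneg _) fun x => ?_
    set z : EuclideanSpace ℂ (Fin K) := WithLp.toLp 2 fun i => (x i : ℂ) with hz
    have h1 : ‖z‖ = ‖x‖ := by
      simp [EuclideanSpace.norm_eq, hz]
    have h2 : ‖Matrix.toEuclideanCLM (n := Fin K) (𝕜 := ℂ) (V.map (algebraMap ℝ ℂ)) z‖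
        = ‖Matrix.toEuclideanCLM (n := Fin K) (𝕜 := ℝ) V x‖ := by
      rw [EuclideanSpace.norm_eq, EuclideanSpace.norm_eq]
      congr 1
      refine Finset.sum_congr rfl fun i _ => ?_
      congr 1
      rw [← Complex.norm_real]
      congr 1
      simp [hz, Matrix.ofLp_toEuclideanCLM, Matrix.mulVec, dotProduct]
    rw [← h1, ← h2]
    exact ContinuousLinearMap.le_opNorm _ _

open scoped Matrix.Norms.L2Operator in
theorem spectralRadius_eq_norm_toEuclideanCLM (V : Matrix (Fin K) (Fin K) ℂ)
    (hV : V * Vᴴ = Vᴴ * V) :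
    (spectralRadius ℂ V).toReal = ‖Matrix.toEuclideanCLM (n := Fin K) (𝕜 := ℂ) V‖ := by
  have : IsStarNormal V := ⟨by
    change star V * V = V * star V
    exact hV.symm⟩
  rw [IsStarNormal.spectralRadius_eq_nnnorm V, ENNReal.coe_toReal, coe_nnnorm,
    Matrix.cstar_norm_def]

/-- Double stochasticity makes `J = (1/K) 1 1ᵀ` absorb `A` and `Aᵀ` on either side, so the deviation
matrix inherits normality from `A`, and the C*-identity applies. -/
theorem mixingRate_eq_deviationSpectralRadius {A : Matrix (Fin K) (Fin K) ℝ}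
    (hA : A ∈ doublyStochastic ℝ (Fin K)) (hn : A * Aᵀ = Aᵀ * A) :
    mixingRate A = deviationSpectralRadius A := by
  set J : Matrix (Fin K) (Fin K) ℝ := Matrix.of fun _ _ => 1 / (K : ℝ) with hJ
  have hJt : Jᵀ = J := by ext; simp [hJ]
  have h1 : A * J = J := by
    ext i j
    simp [Matrix.mul_apply, hJ, ← Finset.sum_mul, sum_row_of_mem_doublyStochastic hA]
  have h2 : J * A = J := by
    ext i j
    simp [Matrix.mul_apply, hJ, ← Finset.mul_sum, sum_col_of_mem_doublyStochastic hA]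
  have h3 : J * Aᵀ = J := by
    have := congrArg Matrix.transpose h1
    rwa [Matrix.transpose_mul, hJt] at this
  have h4 : Aᵀ * J = J := by
    have := congrArg Matrix.transpose h2
    rwa [Matrix.transpose_mul, hJt] at this
  have hV : deviationMatrix A * (deviationMatrix A)ᵀ = (deviationMatrix A)ᵀ * deviationMatrix A := by
    have : deviationMatrix A = Aᵀ - J := rfl
    rw [this, Matrix.transpose_sub, Matrix.transpose_transpose, hJt]
    simp only [Matrix.mul_sub, Matrix.sub_mul, h1, h2, h3, h4, hn]
  have hmap : ((deviationMatrix A).map (algebraMap ℝ ℂ))ᴴ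
      = ((deviationMatrix A)ᵀ).map (algebraMap ℝ ℂ) := by
    ext i j
    simp [Matrix.conjTranspose_apply]
  rw [deviationSpectralRadius, spectralRadius_eq_norm_toEuclideanCLM, norm_toEuclideanCLM_ofReal,
    mixingRate]
  rw [hmap, ← Matrix.map_mul, ← Matrix.map_mul, hV]

end Spectral

/-! ### Moments of sums and averages of independent vectors -/

section Moments

variable {Ω Ω' H : Type*} [MeasurableSpace Ω] [MeasurableSpace Ω'] [NormedAddCommGroup H]
  [InnerProductSpace ℝ H] [CompleteSpace H]

/-- Nonnegativity of the variance. Since `f ≥ 0`, measurability is recovered from that of `f ^ 2` by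
a square root. Applied to squares, it turns fourth-moment hypotheses into second-moment ones. -/
theorem integral_le_of_integral_sq_le {μ : Measure Ω} [IsProbabilityMeasure μ] {f : Ω → ℝ} {c : ℝ}
    (hf : ∀ x, 0 ≤ f x) (hc : 0 ≤ c) (hi : Integrable (fun x => f x ^ 2) μ)
    (hle : ∫ x, f x ^ 2 ∂μ ≤ c ^ 2) : Integrable f μ ∧ ∫ x, f x ∂μ ≤ c := by
  have hm : AEStronglyMeasurable f μ := by
    have := Real.continuous_sqrt.comp_aestronglyMeasurable hi.aestronglyMeasurable
    exact this.congr (ae_of_all _ fun x => Real.sqrt_sq (hf x))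
  have hint : Integrable f μ :=
    ((memLp_two_iff_integrable_sq hm).2 hi).integrable one_le_two
  refine ⟨hint, ?_⟩
  set m := ∫ x, f x ∂μ with hmdef
  have h : ∫ x, (f x - m) ^ 2 ∂μ = ∫ x, f x ^ 2 ∂μ - m ^ 2 := by
    have : ∀ x, (f x - m) ^ 2 = f x ^ 2 - (2 * m * f x - m ^ 2) := fun x => by ring
    simp_rw [this]
    have h1 : Integrable (fun x => 2 * m * f x) μ := hint.const_mul _
    have h2 : Integrable (fun x => 2 * m * f x - m ^ 2) μ := h1.sub (integrable_const _)
    rw [integral_sub hi h2, integral_sub h1 (integrable_const _),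
      integral_const_mul, ← hmdef]
    simp
    ring
  have h0 : 0 ≤ ∫ x, (f x - m) ^ 2 ∂μ := integral_nonneg fun x => sq_nonneg _
  exact le_of_sq_le_sq (by linarith) hc

theorem memLp_nat_iff_integrable_norm_pow {E : Type*} [NormedAddCommGroup E] {μ : Measure Ω}
    {f : Ω → E} (hf : AEStronglyMeasurable f μ) {p : ℕ} (hp : p ≠ 0) :
    MemLp f p μ ↔ Integrable (fun x => ‖f x‖ ^ p) μ := by
  rw [← integrable_norm_rpow_iff hf (by exact_mod_cast hp) (ENNReal.natCast_ne_top p)]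
  simp

theorem memLp_four_iff {E : Type*} [NormedAddCommGroup E] {μ : Measure Ω}
    {f : Ω → E} (hf : AEStronglyMeasurable f μ) :
    MemLp f 4 μ ↔ Integrable (fun x => ‖f x‖ ^ 4) μ := by
  simpa using memLp_nat_iff_integrable_norm_pow hf (p := 4) (by norm_num)

theorem integral_sub_integral_pow_four_le {μ : Measure Ω} [IsProbabilityMeasure μ] {Z : Ω → ℝ}
    (hZ : MemLp Z 4 μ) :
    ∫ x, (Z x - ∫ y, Z y ∂μ) ^ 4 ∂μ ≤ 3 * ∫ x, Z x ^ 4 ∂μ := by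
  set m := ∫ y, Z y ∂μ with hm
  have hi : Integrable Z μ := hZ.integrable (by norm_num)
  have h4 : Integrable (fun x => Z x ^ 4) μ := by
    have := (memLp_four_iff hZ.1).1 hZ
    simpa [Even.pow_abs (show Even 4 by decide)] using this
  have hc : MemLp (fun x => Z x - m) 4 μ := hZ.sub (memLp_const m)
  have h4c : Integrable (fun x => (Z x - m) ^ 4) μ := by
    have := (memLp_four_iff hc.1).1 hc
    simpa [Even.pow_abs (show Even 4 by decide)] using this
  have hlin : ∫ x, (Z x - m) ∂μ = 0 := by
    rw [integral_sub hi (integrable_const _)]; simp [hm]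
  -- With `y = Z x - m`, right side minus left side is `2 * (y * (y + 3 * m)) ^ 2 + 3 * m ^ 4`. The
  -- subtracted linear term has integral zero, which is why the constant can be as small as `3`.
  have hpt : ∀ x, (Z x - m) ^ 4 ≤ 3 * Z x ^ 4 - 12 * m ^ 3 * (Z x - m) := fun x => by
    nlinarith [sq_nonneg ((Z x - m) * ((Z x - m) + 3 * m)), sq_nonneg (m ^ 2)]
  have hr1 : Integrable (fun x => 3 * Z x ^ 4) μ := h4.const_mul _
  have hr2 : Integrable (fun x => 12 * m ^ 3 * (Z x - m)) μ :=
    (hi.sub (integrable_const _)).const_mul _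
  calc ∫ x, (Z x - m) ^ 4 ∂μ ≤ ∫ x, (3 * Z x ^ 4 - 12 * m ^ 3 * (Z x - m)) ∂μ :=
        integral_mono h4c (hr1.sub hr2) hpt
    _ = 3 * ∫ x, Z x ^ 4 ∂μ := by
        rw [integral_sub hr1 hr2, integral_const_mul, integral_const_mul, hlin]; ring

omit [CompleteSpace H] in
theorem integrable_prod_inner {μ : Measure Ω} {ν : Measure Ω'} [SFinite μ] [SFinite ν]
    {f : Ω → H} {g : Ω' → H} (hf : Integrable f μ) (hg : Integrable g ν) :
    Integrable (fun z : Ω × Ω' => inner ℝ (f z.1) (g z.2)) (μ.prod ν) := by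
  refine (hf.norm.mul_prod hg.norm).mono' (hf.1.comp_fst.inner hg.1.comp_snd)
    (ae_of_all _ fun z => norm_inner_le_norm _ _)

theorem integral_prod_inner {μ : Measure Ω} {ν : Measure Ω'} [SFinite μ] [SFinite ν]
    {f : Ω → H} {g : Ω' → H} (hf : Integrable f μ) (hg : Integrable g ν) :
    ∫ z : Ω × Ω', inner ℝ (f z.1) (g z.2) ∂(μ.prod ν)
      = inner ℝ (∫ x, f x ∂μ) (∫ y, g y ∂ν) := by
  rw [integral_prod _ (integrable_prod_inner hf hg)]
  simp only [integral_inner hg]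
  rw [real_inner_comm, ← integral_inner hf]
  simp only [real_inner_comm]

theorem integral_norm_add_sq_prod {μ : Measure Ω} {ν : Measure Ω'} [IsProbabilityMeasure μ]
    [IsProbabilityMeasure ν] {f : Ω → H} {g : Ω' → H} (hf : MemLp f 2 μ) (hg : MemLp g 2 ν)
    (h0 : ∫ x, f x ∂μ = 0) :
    ∫ z : Ω × Ω', ‖f z.1 + g z.2‖ ^ 2 ∂(μ.prod ν) = ∫ x, ‖f x‖ ^ 2 ∂μ + ∫ y, ‖g y‖ ^ 2 ∂ν := by
  have hfi := hf.integrable one_le_two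
  have hgi := hg.integrable one_le_two
  have hf2 := (memLp_two_iff_integrable_sq_norm hf.1).1 hf
  have hg2 := (memLp_two_iff_integrable_sq_norm hg.1).1 hg
  simp_rw [norm_add_sq_real]
  have i1 := hf2.comp_fst ν
  have i2 := (integrable_prod_inner hfi hgi).const_mul 2
  have i3 := hg2.comp_snd μ
  rw [integral_add (i1.fun_add i2) i3, integral_add i1 i2, integral_const_mul,
    integral_prod_inner hfi hgi, h0, inner_zero_left, integral_fun_fst (fun x => ‖f x‖ ^ 2),
    integral_fun_snd (fun y => ‖g y‖ ^ 2)]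
  simp

omit [CompleteSpace H] in
-- The odd cross terms are kept exactly, in a form linear in one of the two vectors: under a product
-- measure they integrate to zero when both vectors are centred. Cauchy–Schwarz merges the even ones
-- into the factor `6 = 2 + 4`.
theorem norm_add_pow_four_le (a b : H) :
    ‖a + b‖ ^ 4 ≤ ‖a‖ ^ 4 + ‖b‖ ^ 4 + 6 * (‖a‖ ^ 2 * ‖b‖ ^ 2) + 4 * inner ℝ a (‖b‖ ^ 2 • b)
      + 4 * inner ℝ (‖a‖ ^ 2 • a) b := by
  have h1 : ‖a + b‖ ^ 4 = (‖a‖ ^ 2 + 2 * inner ℝ a b + ‖b‖ ^ 2) ^ 2 := by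
    rw [← norm_add_sq_real]; ring
  have h2 : (inner ℝ a b : ℝ) ^ 2 ≤ ‖a‖ ^ 2 * ‖b‖ ^ 2 := by
    rw [← mul_pow, ← sq_abs]
    exact pow_le_pow_left₀ (abs_nonneg _) (abs_real_inner_le_norm a b) 2
  rw [h1, inner_smul_right, inner_smul_left]
  simp only [conj_trivial]
  nlinarith

omit [CompleteSpace H] in
theorem MemLp.integrable_norm_sq_smul {μ : Measure Ω} {f : Ω → H} [IsFiniteMeasure μ]
    (hf : MemLp f 4 μ) : Integrable (fun x => ‖f x‖ ^ 2 • f x) μ := by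
  have h3 : MemLp f 3 μ := hf.mono_exponent (by norm_num)
  have h3' : Integrable (fun x => ‖f x‖ ^ 3) μ := by
    simpa using (memLp_nat_iff_integrable_norm_pow hf.1 (p := 3) (by norm_num)).1 (by simpa using h3)
  refine h3'.mono' ((hf.1.norm.pow 2).smul hf.1) (ae_of_all _ fun x => ?_)
  rw [norm_smul, norm_pow, norm_norm, ← pow_succ]

theorem integral_norm_add_pow_four_prod_le {μ : Measure Ω} {ν : Measure Ω'}
    [IsProbabilityMeasure μ] [IsProbabilityMeasure ν] {f : Ω → H} {g : Ω' → H}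
    (hf : MemLp f 4 μ) (hg : MemLp g 4 ν)
    (hf0 : ∫ x, f x ∂μ = 0) (hg0 : ∫ y, g y ∂ν = 0) :
    ∫ z : Ω × Ω', ‖f z.1 + g z.2‖ ^ 4 ∂(μ.prod ν)
      ≤ ∫ x, ‖f x‖ ^ 4 ∂μ + ∫ y, ‖g y‖ ^ 4 ∂ν
        + 6 * ((∫ x, ‖f x‖ ^ 2 ∂μ) * ∫ y, ‖g y‖ ^ 2 ∂ν) := by
  have hfi := hf.integrable (by norm_num)
  have hgi := hg.integrable (by norm_num)
  have hf4 := (memLp_four_iff hf.1).1 hf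
  have hg4 := (memLp_four_iff hg.1).1 hg
  have hf2 := (memLp_two_iff_integrable_sq_norm hf.1).1 (hf.mono_exponent (by norm_num))
  have hg2 := (memLp_two_iff_integrable_sq_norm hg.1).1 (hg.mono_exponent (by norm_num))
  have hf3 := MemLp.integrable_norm_sq_smul hf
  have hg3 := MemLp.integrable_norm_sq_smul hg
  have i1 := hf4.comp_fst ν
  have i2 := hg4.comp_snd μ
  have i3 := (hf2.mul_prod hg2).const_mul 6
  have i4 := (integrable_prod_inner hfi hg3).const_mul 4
  have i5 := (integrable_prod_inner hf3 hgi).const_mul 4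
  have hsum : MemLp (fun z : Ω × Ω' => f z.1 + g z.2) 4 (μ.prod ν) :=
    (hf.comp_fst ν).add (hg.comp_snd μ)
  refine (integral_mono ((memLp_four_iff hsum.1).1 hsum) ((((i1.fun_add i2).fun_add i3).fun_add i4).fun_add i5)
    fun z => norm_add_pow_four_le (f z.1) (g z.2)).trans (le_of_eq ?_)
  rw [integral_add (((i1.fun_add i2).fun_add i3).fun_add i4) i5, integral_add ((i1.fun_add i2).fun_add i3) i4,
    integral_add (i1.fun_add i2) i3, integral_add i1 i2, integral_const_mul, integral_const_mul,
    integral_const_mul, integral_prod_inner hfi hg3, integral_prod_inner hf3 hgi, hf0, hg0,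
    inner_zero_left, inner_zero_right, integral_fun_fst (fun x => ‖f x‖ ^ 4),
    integral_fun_snd (fun y => ‖g y‖ ^ 4),
    integral_prod_mul (fun x => ‖f x‖ ^ 2) (fun y => ‖g y‖ ^ 2)]
  simp

variable {ν : Measure Ω} [IsProbabilityMeasure ν]

theorem memLp_sum_pi {E : Type*} [NormedAddCommGroup E] {f : Ω → E} {p : ENNReal}
    (hf : MemLp f p ν) (n : ℕ) :
    MemLp (fun χ : Fin n → Ω => ∑ i, f (χ i)) p (Measure.pi fun _ => ν) :=
  memLp_finsetSum _ fun i _ =>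
    hf.comp_measurePreserving (measurePreserving_eval (fun _ : Fin n => ν) i)

theorem integrable_comp_eval {E : Type*} [NormedAddCommGroup E]
    {f : Ω → E} (hf : Integrable f ν) {n : ℕ} (i : Fin n) :
    Integrable (fun χ : Fin n → Ω => f (χ i)) (Measure.pi fun _ => ν) :=
  (measurePreserving_eval (fun _ : Fin n => ν) i).integrable_comp_of_integrable hf

theorem integral_comp_eval_pi {E : Type*} [NormedAddCommGroup E] [NormedSpace ℝ E]
    {f : Ω → E} (hf : Integrable f ν) {n : ℕ} (i : Fin n) :
    ∫ χ : Fin n → Ω, f (χ i) ∂(Measure.pi fun _ => ν) = ∫ x, f x ∂ν := by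
  have h := measurePreserving_eval (fun _ : Fin n => ν) i
  have h1 := integral_map h.measurable.aemeasurable (f := f) (by rw [h.map_eq]; exact hf.1)
  rw [h.map_eq] at h1
  exact h1.symm

theorem integral_sum_pi {E : Type*} [NormedAddCommGroup E] [NormedSpace ℝ E]
    {f : Ω → E} (hf : Integrable f ν) (n : ℕ) :
    ∫ χ : Fin n → Ω, ∑ i, f (χ i) ∂(Measure.pi fun _ => ν) = n • ∫ x, f x ∂ν := by
  rw [integral_finsetSum _ fun i _ => integrable_comp_eval hf i]
  simp [integral_comp_eval_pi hf]

/-- Splitting off the first coordinate makes a batch of `n + 1` a product of one point and a batch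
of `n`, so that two-factor moment formulas give inductions on the batch size. -/
theorem integral_pi_succ {E : Type*} [NormedAddCommGroup E] [NormedSpace ℝ E] {n : ℕ}
    (F : (Fin (n + 1) → Ω) → E) :
    ∫ χ, F χ ∂(Measure.pi fun _ => ν)
      = ∫ z : Ω × (Fin n → Ω), F (Fin.cons z.1 z.2) ∂(ν.prod (Measure.pi fun _ => ν)) := by
  have h := (measurePreserving_piFinSuccAbove (fun _ : Fin (n + 1) => ν) 0).symm
  rw [← h.integral_comp (MeasurableEquiv.measurableEmbedding _)]
  refine integral_congr_ae (ae_of_all _ fun z => ?_)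
  simp [MeasurableEquiv.piFinSuccAbove, Fin.insertNthEquiv]

theorem integral_norm_sum_sq_pi {f : Ω → H} (hf : MemLp f 2 ν) (h0 : ∫ x, f x ∂ν = 0) (n : ℕ) :
    ∫ χ : Fin n → Ω, ‖∑ i, f (χ i)‖ ^ 2 ∂(Measure.pi fun _ => ν) = n * ∫ x, ‖f x‖ ^ 2 ∂ν := by
  induction n with
  | zero => simp
  | succ n ih =>
    rw [integral_pi_succ]
    simp only [Fin.sum_univ_succ, Fin.cons_zero, Fin.cons_succ]
    rw [integral_norm_add_sq_prod (g := fun y : Fin n → Ω => ∑ i, f (y i)) hf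
      (memLp_sum_pi hf n) h0, ih]
    push_cast
    ring

/-- One more summand adds at most `T ^ 2 + 6 * n * T ^ 2`, below the increment `3 * (2 * n + 1) * T
^ 2` of the bound. The quadratic growth in `n` is what leaves order `n⁻²` after averaging. -/
theorem integral_norm_sum_pow_four_pi_le {f : Ω → H} (hf : MemLp f 4 ν)
    (h0 : ∫ x, f x ∂ν = 0) {T : ℝ} (h2 : ∫ x, ‖f x‖ ^ 2 ∂ν ≤ T)
    (h4 : ∫ x, ‖f x‖ ^ 4 ∂ν ≤ T ^ 2) (n : ℕ) :
    ∫ χ : Fin n → Ω, ‖∑ i, f (χ i)‖ ^ 4 ∂(Measure.pi fun _ => ν) ≤ 3 * n ^ 2 * T ^ 2 := by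
  induction n with
  | zero => simp
  | succ n ih =>
    rw [integral_pi_succ]
    simp only [Fin.sum_univ_succ, Fin.cons_zero, Fin.cons_succ]
    have hs0 : ∫ χ : Fin n → Ω, ∑ i, f (χ i) ∂(Measure.pi fun _ => ν) = 0 := by
      rw [integral_sum_pi (hf.integrable (by norm_num)), h0, smul_zero]
    refine (integral_norm_add_pow_four_prod_le (g := fun y : Fin n → Ω => ∑ i, f (y i)) hf
      (memLp_sum_pi hf n) h0 hs0).trans ?_
    rw [integral_norm_sum_sq_pi (hf.mono_exponent (by norm_num)) h0]
    have hn : (0 : ℝ) ≤ n := n.cast_nonneg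
    have hpos : 0 ≤ ∫ x, ‖f x‖ ^ 2 ∂ν := integral_nonneg fun x => by positivity
    have h5 : (∫ x, ‖f x‖ ^ 2 ∂ν) * (n * ∫ x, ‖f x‖ ^ 2 ∂ν) ≤ n * T ^ 2 := by
      rw [mul_left_comm, ← sq]
      gcongr
    push_cast
    nlinarith [sq_nonneg T]

theorem integral_norm_average_sq_pi {f : Ω → H} (hf : MemLp f 2 ν) (h0 : ∫ x, f x ∂ν = 0)
    {n : ℕ} (hn : 0 < n) :
    ∫ χ : Fin n → Ω, ‖(1 / (n : ℝ)) • ∑ i, f (χ i)‖ ^ 2 ∂(Measure.pi fun _ => ν)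
      = (∫ x, ‖f x‖ ^ 2 ∂ν) / n := by
  have hn' : (0 : ℝ) < n := by exact_mod_cast hn
  simp_rw [norm_smul, mul_pow]
  rw [integral_const_mul, integral_norm_sum_sq_pi hf h0]
  rw [Real.norm_of_nonneg (by positivity)]
  field_simp

theorem integral_norm_average_pow_four_pi_le {f : Ω → H} (hf : MemLp f 4 ν)
    (h0 : ∫ x, f x ∂ν = 0) {T : ℝ} (h2 : ∫ x, ‖f x‖ ^ 2 ∂ν ≤ T)
    (h4 : ∫ x, ‖f x‖ ^ 4 ∂ν ≤ T ^ 2) {n : ℕ} (hn : 0 < n) :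
    ∫ χ : Fin n → Ω, ‖(1 / (n : ℝ)) • ∑ i, f (χ i)‖ ^ 4 ∂(Measure.pi fun _ => ν)
      ≤ 3 * T ^ 2 / n ^ 2 := by
  have hn' : (0 : ℝ) < n := by exact_mod_cast hn
  simp_rw [norm_smul, mul_pow]
  rw [integral_const_mul, Real.norm_of_nonneg (by positivity)]
  calc (1 / (n : ℝ)) ^ 4 * _ ≤ (1 / (n : ℝ)) ^ 4 * (3 * n ^ 2 * T ^ 2) := by
        gcongr
        exact integral_norm_sum_pow_four_pi_le hf h0 h2 h4 n
    _ = 3 * T ^ 2 / n ^ 2 := by field_simp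

theorem memLp_average_pi {E : Type*} [NormedAddCommGroup E] [NormedSpace ℝ E] {f : Ω → E}
    {p : ENNReal} (hf : MemLp f p ν) (n : ℕ) :
    MemLp (fun χ : Fin n → Ω => (1 / (n : ℝ)) • ∑ i, f (χ i)) p (Measure.pi fun _ => ν) :=
  (memLp_sum_pi hf n).const_smul _

theorem integrable_average_pi {E : Type*} [NormedAddCommGroup E] [NormedSpace ℝ E]
    {f : Ω → E} (hf : Integrable f ν) (n : ℕ) :
    Integrable (fun χ : Fin n → Ω => (1 / (n : ℝ)) • ∑ i, f (χ i)) (Measure.pi fun _ => ν) := by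
  have h := integrable_finsetSum (μ := Measure.pi fun _ => ν) Finset.univ
    fun (i : Fin n) _ => integrable_comp_eval hf i
  exact h.smul (1 / (n : ℝ))

theorem integral_average_pi {E : Type*} [NormedAddCommGroup E] [NormedSpace ℝ E]
    {f : Ω → E} (hf : Integrable f ν) {n : ℕ} (hn : 0 < n) :
    ∫ χ : Fin n → Ω, (1 / (n : ℝ)) • ∑ i, f (χ i) ∂(Measure.pi fun _ => ν) = ∫ x, f x ∂ν := by
  have hn' : (0 : ℝ) < n := by exact_mod_cast hn
  rw [integral_smul, integral_sum_pi hf, ← Nat.cast_smul_eq_nsmul ℝ, smul_smul,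
    one_div_mul_cancel hn'.ne', one_smul]

/-- The average of independent copies has a second moment of at most the squared mean plus the
second moment about any point divided by the number of copies. -/
theorem integral_norm_average_sq_pi_le {f : Ω → H} (hf : MemLp f 2 ν) (a : H)
    {n : ℕ} (hn : 0 < n) :
    ∫ χ : Fin n → Ω, ‖(1 / (n : ℝ)) • ∑ i, f (χ i)‖ ^ 2 ∂(Measure.pi fun _ => ν)
      ≤ ‖∫ x, f x ∂ν‖ ^ 2 + (∫ x, ‖f x - a‖ ^ 2 ∂ν) / n := by
  have hn' : (0 : ℝ) < n := by exact_mod_cast hn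
  have hfi := hf.integrable one_le_two
  set m := ∫ x, f x ∂ν with hm
  have hc : MemLp (fun x => f x - m) 2 ν := hf.sub (memLp_const m)
  have hci := hc.integrable one_le_two
  have hc0 : ∫ x, (f x - m) ∂ν = 0 := by
    rw [integral_sub hfi (integrable_const _)]; simp [hm]
  -- The second moment is least about the mean.
  have hvar : ∫ x, ‖f x - m‖ ^ 2 ∂ν ≤ ∫ x, ‖f x - a‖ ^ 2 ∂ν := by
    have hexp : ∀ x, ‖f x - a‖ ^ 2
        = ‖f x - m‖ ^ 2 + 2 * inner ℝ (m - a) (f x - m) + ‖m - a‖ ^ 2 := fun x => by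
      rw [real_inner_comm, ← norm_add_sq_real, sub_add_sub_cancel]
    simp_rw [hexp]
    have i1 := (memLp_two_iff_integrable_sq_norm hc.1).1 hc
    have i2 := (hci.const_inner (𝕜 := ℝ) (m - a)).const_mul 2
    rw [integral_add (i1.fun_add i2) (integrable_const _), integral_add i1 i2, integral_const_mul,
      integral_inner hci, hc0]
    simp
  have hexp : ∀ χ : Fin n → Ω, ‖(1 / (n : ℝ)) • ∑ i, f (χ i)‖ ^ 2
      = ‖(1 / (n : ℝ)) • ∑ i, (f (χ i) - m)‖ ^ 2
        + 2 * inner ℝ m ((1 / (n : ℝ)) • ∑ i, (f (χ i) - m)) + ‖m‖ ^ 2 := fun χ => by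
    rw [real_inner_comm, ← norm_add_sq_real]
    congr 2
    rw [Finset.sum_sub_distrib, smul_sub]
    simp [← Nat.cast_smul_eq_nsmul ℝ, smul_smul, hn'.ne']
  simp_rw [hexp]
  have hav := memLp_average_pi hc n
  have havi := hav.integrable one_le_two
  have i1 := (memLp_two_iff_integrable_sq_norm hav.1).1 hav
  have i2 := (havi.const_inner (𝕜 := ℝ) m).const_mul 2
  rw [integral_add (i1.fun_add i2) (integrable_const _), integral_add i1 i2, integral_const_mul,
      integral_inner havi, integral_average_pi hci hn, hc0, integral_norm_average_sq_pi hc hc0 hn]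
  simp only [inner_zero_right, mul_zero, add_zero, integral_const, probReal_univ, one_smul]
  rw [add_comm]
  gcongr

end Moments

/-! ### Joint measurability of derivatives in data and parameter -/

section MeasurableDerivative

variable {M : ℕ} {Z F : Type*} [MeasurableSpace Z] [NormedAddCommGroup F] [NormedSpace ℝ F]
  [MeasurableSpace F] [BorelSpace F] [SecondCountableTopology F]

/-- A directional derivative is the pointwise limit of the difference quotients with steps `1 / (n +
1)`. Measurability jointly with the base point is required because the gradients are evaluated at
random iterates. -/
theorem measurable_fderiv_apply_of_joint {f : Z → Param M → F}
    (hf : Measurable fun q : Z × Param M => f q.1 q.2) (hd : ∀ z, Differentiable ℝ (f z))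
    (e : Param M) : Measurable fun q : Z × Param M => fderiv ℝ (f q.1) q.2 e := by
  have hlim : Tendsto (fun n : ℕ => (1 / ((n : ℝ) + 1))) atTop (𝓝[≠] 0) := by
    refine tendsto_nhdsWithin_iff.2 ⟨tendsto_one_div_add_atTop_nhds_zero_nat, ?_⟩
    exact Eventually.of_forall fun n => by
      have : (0 : ℝ) < 1 / ((n : ℝ) + 1) := by positivity
      exact this.ne'
  refine measurable_of_tendsto_metrizable (f := fun (n : ℕ) (q : Z × Param M) =>
    (1 / ((n : ℝ) + 1))⁻¹ • (f q.1 (q.2 + (1 / ((n : ℝ) + 1)) • e) - f q.1 q.2)) (fun n => ?_) ?_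
  · have h1 : Measurable fun q : Z × Param M => f q.1 (q.2 + (1 / ((n : ℝ) + 1)) • e) :=
      hf.comp (measurable_fst.prodMk (measurable_snd.add_const _))
    exact (h1.sub hf).const_smul _
  · rw [tendsto_pi_nhds]
    intro q
    exact (((hd q.1 q.2).hasFDerivAt.hasLineDerivAt e).tendsto_slope_zero).comp hlim

/-- In finite dimension an operator is a continuous function of its values on the standard basis. -/
theorem measurable_fderiv_of_joint {f : Z → Param M → F}
    (hf : Measurable fun q : Z × Param M => f q.1 q.2) (hd : ∀ z, Differentiable ℝ (f z)) :
    Measurable fun q : Z × Param M => fderiv ℝ (f q.1) q.2 := by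
  have hrep : ∀ T : Param M →L[ℝ] F, T = ∑ j, ContinuousLinearMap.smulRightL ℝ (Param M) F
      (EuclideanSpace.proj j) (T (EuclideanSpace.single j 1)) := by
    intro T
    ext v
    have hv : v = ∑ j, v j • EuclideanSpace.single j (1 : ℝ) := by
      ext i
      simp [Pi.single_apply]
    conv_lhs => rw [hv]
    simp
  have : (fun q : Z × Param M => fderiv ℝ (f q.1) q.2) = fun q =>
      ∑ j, ContinuousLinearMap.smulRightL ℝ (Param M) F
        (EuclideanSpace.proj j) (fderiv ℝ (f q.1) q.2 (EuclideanSpace.single j 1)) :=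
    funext fun q => hrep _
  rw [this]
  refine Finset.measurable_sum _ fun j _ => ?_
  exact (ContinuousLinearMap.continuous _).measurable.comp
    (measurable_fderiv_apply_of_joint hf hd _)

theorem measurable_gradient_of_joint {f : Z → Param M → ℝ}
    (hf : Measurable fun q : Z × Param M => f q.1 q.2) (hd : ∀ z, Differentiable ℝ (f z)) :
    Measurable fun q : Z × Param M => gradient (f q.1) q.2 :=
  (InnerProductSpace.toDual ℝ (Param M)).symm.continuous.measurable.comp
    (measurable_fderiv_of_joint hf hd)

end MeasurableDerivative

/-! ### Gradients and Hessians of the risks -/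

theorem norm_gradient_eq {M : ℕ} (f : Param M → ℝ) (p : Param M) :
    ‖gradient f p‖ = ‖fderiv ℝ f p‖ :=
  (InnerProductSpace.toDual ℝ (Param M)).symm.norm_map _

theorem inner_gradient_eq {M : ℕ} (f : Param M → ℝ) (p e : Param M) :
    inner ℝ (gradient f p) e = fderiv ℝ f p e := by
  rw [gradient, InnerProductSpace.toDual_symm_apply]

namespace Agent

variable {M : ℕ} {a : Agent.{u, v} M}

/-- The gradient of the loss at a data point. -/
noncomputable abbrev lossGradient (a : Agent.{u, v} M) (t : a.Task) (p : Param M) (x : a.Data) :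
    Param M :=
  gradient (fun y => a.loss t y x) p

/-- The Hessian of the loss at a data point. -/
noncomputable abbrev lossHessian (a : Agent.{u, v} M) (t : a.Task) (p : Param M) (x : a.Data) :
    Param M →L[ℝ] Param M :=
  hessian (fun y => a.loss t y x) p

theorem Regular.measurable_lossGradient (hr : a.Regular) :
    Measurable fun q : a.Task × Param M × a.Data => a.lossGradient q.1 q.2.1 q.2.2 := by
  have h1 : Measurable fun q : (a.Task × a.Data) × Param M => a.loss q.1.1 q.2 q.1.2 :=
    hr.measurable_loss.comp (f := fun q : (a.Task × a.Data) × Param M => (q.1.1, q.2, q.1.2))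
      (by fun_prop)
  have h2 := measurable_gradient_of_joint (f := fun (z : a.Task × a.Data) y => a.loss z.1 y z.2)
    h1 (fun z => hr.differentiable_loss z.1 z.2)
  exact h2.comp (f := fun q : a.Task × Param M × a.Data => ((q.1, q.2.2), q.2.1)) (by fun_prop)

theorem Regular.measurable_lossHessian (hr : a.Regular) :
    Measurable fun q : a.Task × Param M × a.Data => a.lossHessian q.1 q.2.1 q.2.2 := by
  have h1 : Measurable fun q : (a.Task × a.Data) × Param M => a.lossGradient q.1.1 q.2 q.1.2 :=
    hr.measurable_lossGradient.comp
      (f := fun q : (a.Task × a.Data) × Param M => (q.1.1, q.2, q.1.2)) (by fun_prop)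
  have h2 := measurable_fderiv_of_joint
    (f := fun (z : a.Task × a.Data) y => a.lossGradient z.1 y z.2)
    h1 (fun z => hr.differentiable_gradient z.1 z.2)
  exact h2.comp (f := fun q : a.Task × Param M × a.Data => ((q.1, q.2.2), q.2.1)) (by fun_prop)

theorem Regular.measurable_lossGradient_data (hr : a.Regular) (t : a.Task) (p : Param M) :
    Measurable (a.lossGradient t p) :=
  hr.measurable_lossGradient.comp (f := fun x : a.Data => (t, p, x)) (by fun_prop)

theorem Regular.measurable_lossHessian_data (hr : a.Regular) (t : a.Task) (p : Param M) :
    Measurable (a.lossHessian t p) :=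
  hr.measurable_lossHessian.comp (f := fun x : a.Data => (t, p, x)) (by fun_prop)

theorem Regular.gradient_batchLoss (hr : a.Regular) {N : ℕ} (t : a.Task) (χ : Fin N → a.Data) :
    gradient (a.batchLoss t χ) = fun p => (1 / (N : ℝ)) • ∑ n, a.lossGradient t p (χ n) := by
  funext p
  have h1 : HasFDerivAt (a.batchLoss t χ)
      ((1 / (N : ℝ)) • ∑ n, fderiv ℝ (fun y => a.loss t y (χ n)) p) p := by
    refine HasFDerivAt.const_mul (HasFDerivAt.fun_sum fun n _ => ?_) _
    exact (hr.differentiable_loss t (χ n) p).hasFDerivAt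
  rw [gradient, h1.fderiv]
  simp [gradient]

theorem Regular.hessian_batchLoss (hr : a.Regular) {N : ℕ} (t : a.Task) (χ : Fin N → a.Data)
    (p : Param M) :
    hessian (a.batchLoss t χ) p = (1 / (N : ℝ)) • ∑ n, a.lossHessian t p (χ n) := by
  have h1 : HasFDerivAt (fun p => (1 / (N : ℝ)) • ∑ n, a.lossGradient t p (χ n))
      ((1 / (N : ℝ)) • ∑ n, a.lossHessian t p (χ n)) p := by
    refine HasFDerivAt.fun_const_smul (HasFDerivAt.fun_sum fun n _ => ?_) (1 / (N : ℝ))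
    exact (hr.differentiable_gradient t (χ n) p).hasFDerivAt
  rw [hessian, hr.gradient_batchLoss, h1.fderiv]

theorem BoundedGradients.nonneg {B : ℝ} (hB : a.BoundedGradients B) : 0 ≤ B := by
  obtain ⟨t⟩ := nonempty_of_isProbabilityMeasure a.taskLaw
  exact (integral_nonneg fun x => norm_nonneg _).trans (hB t 0).2

theorem integrable_lossGradient (hr : a.Regular) {B : ℝ} (hB : a.BoundedGradients B) (t : a.Task)
    (p : Param M) : Integrable (a.lossGradient t p) (a.dataLaw t) :=
  (integrable_norm_iff (hr.measurable_lossGradient_data t p).aestronglyMeasurable).1 (hB t p).1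

section

variable {L B : ℝ} (hr : a.Regular) (hL : a.LipschitzGradients L) (hL0 : 0 ≤ L)
  (hB : a.BoundedGradients B)
include hr hL hB

/-- Differentiation under the integral: on the unit ball around `p` the gradient of the loss is
dominated by `‖∇Q(p)‖ + |ℓ|`, which is integrable by the moment assumptions. -/
theorem hasFDerivAt_risk (t : a.Task) (p : Param M) :
    Integrable (fun x => fderiv ℝ (fun y => a.loss t y x) p) (a.dataLaw t) ∧
    HasFDerivAt (a.risk t) (∫ x, fderiv ℝ (fun y => a.loss t y x) p ∂(a.dataLaw t)) p := by
  obtain ⟨ℓ, hℓ, hlip, -⟩ := hL t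
  have hm : Measurable fun x => fderiv ℝ (fun y => a.loss t y x) p := by
    have : (fun x => fderiv ℝ (fun y => a.loss t y x) p)
        = fun x => InnerProductSpace.toDual ℝ (Param M) (a.lossGradient t p x) := by
      funext x; simp [gradient]
    rw [this]
    exact (InnerProductSpace.toDual ℝ (Param M)).continuous.measurable.comp
      (hr.measurable_lossGradient_data t p)
  refine hasFDerivAt_integral_of_dominated_loc_of_lip' (𝕜 := ℝ) (F := fun y x => a.loss t y x)
    (bound := fun x => ‖a.lossGradient t p x‖ + |ℓ x|)
    (Metric.ball_mem_nhds p one_pos) (fun y _ => (hr.integrable_loss t y).1)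
    (hr.integrable_loss t p) hm.aestronglyMeasurable ?_
    ((hB t p).1.add (hℓ.integrable one_le_two).abs)
    (ae_of_all _ fun x => (hr.differentiable_loss t x p).hasFDerivAt)
  filter_upwards [hlip] with x hx y hy
  refine Convex.norm_image_sub_le_of_norm_fderiv_le (𝕜 := ℝ) (s := Metric.ball p 1)
    (fun z _ => hr.differentiable_loss t x z) (fun z hz => ?_) (convex_ball p 1)
    (Metric.mem_ball_self one_pos) hy
  rw [← norm_gradient_eq]
  have h1 := hx z p
  have h2 : ℓ x * ‖z - p‖ ≤ |ℓ x| := by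
    calc ℓ x * ‖z - p‖ ≤ |ℓ x| * 1 := by
          gcongr
          · exact le_abs_self _
          · exact (mem_ball_iff_norm.1 hz).le
      _ = |ℓ x| := mul_one _
  calc ‖gradient (fun y => a.loss t y x) z‖
      ≤ ‖gradient (fun y => a.loss t y x) p‖ + ‖gradient (fun y => a.loss t y x) z
          - gradient (fun y => a.loss t y x) p‖ := norm_le_insert' _ _
    _ ≤ _ := by linarith

theorem gradient_risk (t : a.Task) :
    gradient (a.risk t) = fun p => ∫ x, a.lossGradient t p x ∂(a.dataLaw t) := by
  funext p
  obtain ⟨hi, hd⟩ := hasFDerivAt_risk hr hL hB t p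
  refine ext_inner_right ℝ fun e => ?_
  rw [inner_gradient_eq, hd.fderiv, ContinuousLinearMap.integral_apply hi, real_inner_comm,
    ← integral_inner (integrable_lossGradient hr hB t p)]
  refine integral_congr_ae (ae_of_all _ fun x => ?_)
  dsimp only
  rw [real_inner_comm, inner_gradient_eq]

theorem norm_gradient_risk_le (t : a.Task) (p : Param M) : ‖gradient (a.risk t) p‖ ≤ B := by
  rw [gradient_risk hr hL hB]
  exact (norm_integral_le_integral_norm _).trans (hB t p).2

omit hr hB in
include hL0 in
-- The absolute value makes the random Lipschitz constant nonnegative, and the second-moment bound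
-- then yields a first-moment bound with the same `L`.
theorem exists_lipschitz_constant (t : a.Task) :
    ∃ ℓ : a.Data → ℝ, (∀ x, 0 ≤ ℓ x) ∧ MemLp ℓ 2 (a.dataLaw t) ∧
    (∀ᵐ x ∂(a.dataLaw t), ∀ p q : Param M,
      ‖a.lossGradient t p x - a.lossGradient t q x‖ ≤ ℓ x * ‖p - q‖) ∧
    ∫ x, ℓ x ^ 2 ∂(a.dataLaw t) ≤ L ^ 2 ∧ ∫ x, ℓ x ∂(a.dataLaw t) ≤ L := by
  obtain ⟨ℓ, hℓ, hlip, hle⟩ := hL t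
  have hsq : ∫ x, |ℓ x| ^ 2 ∂(a.dataLaw t) ≤ L ^ 2 := by simpa using hle
  refine ⟨fun x => |ℓ x|, fun x => abs_nonneg _, hℓ.abs, ?_, hsq, ?_⟩
  · filter_upwards [hlip] with x hx p q
    exact (hx p q).trans (by gcongr; exact le_abs_self _)
  · exact (integral_le_of_integral_sq_le (fun x => abs_nonneg _) hL0
      ((memLp_two_iff_integrable_sq_norm hℓ.1).1 hℓ) hsq).2

omit hr hL hB in
theorem norm_lossHessian_le_of_lipschitz {t : a.Task} {x : a.Data} {c : ℝ} (hc : 0 ≤ c)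
    (h : ∀ p q : Param M, ‖a.lossGradient t p x - a.lossGradient t q x‖ ≤ c * ‖p - q‖)
    (p : Param M) : ‖a.lossHessian t p x‖ ≤ c :=
  norm_fderiv_le_of_lip' ℝ hc (Eventually.of_forall fun q => h q p)

include hL0 in
theorem norm_gradient_risk_sub_le (t : a.Task) (p q : Param M) :
    ‖gradient (a.risk t) p - gradient (a.risk t) q‖ ≤ L * ‖p - q‖ := by
  obtain ⟨ℓ, hℓ0, hℓ, hlip, -, hle⟩ := exists_lipschitz_constant hL hL0 t
  have hg := integrable_lossGradient hr hB t
  rw [gradient_risk hr hL hB, ← integral_sub (hg p) (hg q)]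
  calc ‖∫ x, (a.lossGradient t p x - a.lossGradient t q x) ∂(a.dataLaw t)‖
      ≤ ∫ x, ℓ x * ‖p - q‖ ∂(a.dataLaw t) :=
        norm_integral_le_of_norm_le ((hℓ.integrable one_le_two).mul_const _)
          (hlip.mono fun x hx => hx p q)
    _ ≤ L * ‖p - q‖ := by
        rw [integral_mul_const]
        gcongr

omit hB in
include hL0 in
theorem memLp_lossHessian (t : a.Task) (p : Param M) :
    MemLp (a.lossHessian t p) 2 (a.dataLaw t) ∧
    ∫ x, ‖a.lossHessian t p x‖ ^ 2 ∂(a.dataLaw t) ≤ L ^ 2 ∧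
    ∫ x, ‖a.lossHessian t p x‖ ∂(a.dataLaw t) ≤ L := by
  obtain ⟨ℓ, hℓ0, hℓ, hlip, hsq, hle⟩ := exists_lipschitz_constant hL hL0 t
  have hbd : ∀ᵐ x ∂(a.dataLaw t), ‖a.lossHessian t p x‖ ≤ ℓ x :=
    hlip.mono fun x hx => norm_lossHessian_le_of_lipschitz (hℓ0 x) hx p
  have hm : MemLp (a.lossHessian t p) 2 (a.dataLaw t) :=
    hℓ.mono' (hr.measurable_lossHessian_data t p).aestronglyMeasurable hbd
  refine ⟨hm, ?_, ?_⟩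
  · refine (integral_mono_ae ((memLp_two_iff_integrable_sq_norm hm.1).1 hm)
      ((memLp_two_iff_integrable_sq hℓ.1).1 hℓ) ?_).trans hsq
    filter_upwards [hbd] with x hx
    gcongr
  · exact (integral_mono_ae (hm.integrable one_le_two).norm (hℓ.integrable one_le_two) hbd).trans hle

include hL0 in
theorem hessian_risk (t : a.Task) (p : Param M) :
    hessian (a.risk t) p = ∫ x, a.lossHessian t p x ∂(a.dataLaw t) := by
  obtain ⟨ℓ, hℓ0, hℓ, hlip, -, -⟩ := exists_lipschitz_constant hL hL0 t
  rw [hessian, gradient_risk hr hL hB]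
  refine (hasFDerivAt_integral_of_dominated_loc_of_lip' (𝕜 := ℝ)
    (F := fun y x => a.lossGradient t y x) (bound := ℓ) (s := Set.univ)
    univ_mem (fun y _ => (integrable_lossGradient hr hB t y).1)
    (integrable_lossGradient hr hB t p)
    (hr.measurable_lossHessian_data t p).aestronglyMeasurable
    (hlip.mono fun x hx y _ => hx y p) (hℓ.integrable one_le_two)
    (ae_of_all _ fun x => (hr.differentiable_gradient t x p).hasFDerivAt)).2.fderiv

include hL0 in
theorem norm_hessian_risk_le (t : a.Task) (p : Param M) : ‖hessian (a.risk t) p‖ ≤ L := by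
  rw [hessian_risk hr hL hL0 hB]
  exact (norm_integral_le_integral_norm _).trans (memLp_lossHessian hr hL hL0 t p).2.2

/-- The mean risk is `B`-Lipschitz because every task risk is. A Lipschitz constant bounds `fderiv`
even where the function is not differentiable, the default value being zero, so no differentiation
under the task integral is needed. -/
theorem norm_gradient_meanRisk_le (p : Param M) : ‖gradient a.meanRisk p‖ ≤ B := by
  rw [norm_gradient_eq]
  refine norm_fderiv_le_of_lip' ℝ hB.nonneg (Eventually.of_forall fun q => ?_)
  have hrisk : ∀ t, ‖a.risk t q - a.risk t p‖ ≤ B * ‖q - p‖ := fun t =>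
    Convex.norm_image_sub_le_of_norm_fderiv_le (𝕜 := ℝ) (s := Set.univ)
      (fun z _ => (hasFDerivAt_risk hr hL hB t z).2.differentiableAt)
      (fun z _ => by rw [← norm_gradient_eq]; exact norm_gradient_risk_le hr hL hB t z)
      convex_univ (Set.mem_univ _) (Set.mem_univ _)
  rw [meanRisk, meanRisk, ← integral_sub (hr.integrable_risk q) (hr.integrable_risk p)]
  simpa using norm_integral_le_of_norm_le_const (μ := a.taskLaw) (ae_of_all _ hrisk)

end

end Agent

/-! ### Sampling: iterated integrals, measurability, noise of batch averages -/

theorem lintegral_ofReal_le_of_integral_le {Ω : Type*} [MeasurableSpace Ω] {μ : Measure Ω}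
    {f : Ω → ℝ} {c : ℝ} (hf : ∀ x, 0 ≤ f x) (hi : Integrable f μ) (hc : ∫ x, f x ∂μ ≤ c) :
    ∫⁻ x, ENNReal.ofReal (f x) ∂μ ≤ ENNReal.ofReal c := by
  rw [← ofReal_integral_eq_lintegral_ofReal hi (ae_of_all _ hf)]
  exact ENNReal.ofReal_le_ofReal hc

/-- With its converse direction, this allows nested expectations to be estimated as lower integrals,
where Tonelli requires no integrability and monotonicity no measurability of the intermediate
bounds; integrability is an outcome. -/
theorem integral_le_of_lintegral_ofReal_le {Ω : Type*} [MeasurableSpace Ω] {μ : Measure Ω}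
    {f : Ω → ℝ} {c : ℝ} (hf : ∀ x, 0 ≤ f x) (hm : AEStronglyMeasurable f μ) (hc0 : 0 ≤ c)
    (hc : ∫⁻ x, ENNReal.ofReal (f x) ∂μ ≤ ENNReal.ofReal c) :
    Integrable f μ ∧ ∫ x, f x ∂μ ≤ c := by
  have hi : Integrable f μ := by
    refine ⟨hm, ?_⟩
    rw [hasFiniteIntegral_iff_ofReal (ae_of_all _ hf)]
    exact hc.trans_lt ENNReal.ofReal_lt_top
  refine ⟨hi, ?_⟩
  rw [integral_eq_lintegral_of_nonneg_ae (ae_of_all _ hf) hm]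
  exact ENNReal.toReal_le_of_le_ofReal hc0 hc

theorem norm_add_four_sq_le {H : Type*} [SeminormedAddCommGroup H] (a b c d : H) :
    ‖a + b + c + d‖ ^ 2 ≤ 4 * (‖a‖ ^ 2 + ‖b‖ ^ 2 + ‖c‖ ^ 2 + ‖d‖ ^ 2) := by
  have h : ‖a + b + c + d‖ ≤ ‖a‖ + ‖b‖ + ‖c‖ + ‖d‖ :=
    (norm_add_le _ _).trans (add_le_add_left (norm_add₃_le) _)
  have h2 := pow_le_pow_left₀ (norm_nonneg _) h 2
  nlinarith [sq_nonneg (‖a‖ - ‖b‖), sq_nonneg (‖a‖ - ‖c‖), sq_nonneg (‖a‖ - ‖d‖),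
    sq_nonneg (‖b‖ - ‖c‖), sq_nonneg (‖b‖ - ‖d‖), sq_nonneg (‖c‖ - ‖d‖)]

namespace Agent

variable {M : ℕ} {a : Agent.{u, v} M}

instance (a : Agent.{u, v} M) (Nin Nout : ℕ) : IsProbabilityMeasure (a.sampleLaw Nin Nout) := by
  unfold sampleLaw; infer_instance

theorem lintegral_sampleLaw {Nin Nout : ℕ} {F : a.Sample Nin Nout → ENNReal} (hF : Measurable F) :
    ∫⁻ s, F s ∂(a.sampleLaw Nin Nout)
      = ∫⁻ t, ∫⁻ χ, ∫⁻ χ', F (t, χ, χ') ∂(Measure.pi fun _ => a.dataLaw t)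
          ∂(Measure.pi fun _ => a.dataLaw t) ∂a.taskLaw := by
  rw [sampleLaw, Measure.lintegral_compProd hF]
  refine lintegral_congr fun t => ?_
  rw [Kernel.prod_apply]
  exact lintegral_prod _ (hF.comp (measurable_const.prodMk measurable_id)).aemeasurable

theorem Regular.measurable_sampleMetaGradient (hr : a.Regular) {Nin Nout : ℕ} (α : ℝ) :
    Measurable fun q : a.Sample Nin Nout × Param M => a.sampleMetaGradient α q.1 q.2 := by
  have hg : ∀ (N : ℕ), Measurable fun q : a.Task × (Fin N → a.Data) × Param M =>
      (1 / (N : ℝ)) • ∑ n, a.lossGradient q.1 q.2.2 (q.2.1 n) := fun N => by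
    refine Measurable.const_smul (g := fun q : a.Task × (Fin N → a.Data) × Param M =>
      ∑ n, a.lossGradient q.1 q.2.2 (q.2.1 n)) ?_ (1 / (N : ℝ))
    exact Finset.measurable_sum _ fun n _ => hr.measurable_lossGradient.comp
      (f := fun q : a.Task × (Fin N → a.Data) × Param M => (q.1, q.2.2, q.2.1 n)) (by fun_prop)
  have hh : ∀ (N : ℕ), Measurable fun q : a.Task × (Fin N → a.Data) × Param M =>
      (1 / (N : ℝ)) • ∑ n, a.lossHessian q.1 q.2.2 (q.2.1 n) := fun N => by
    refine Measurable.const_smul (g := fun q : a.Task × (Fin N → a.Data) × Param M =>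
      ∑ n, a.lossHessian q.1 q.2.2 (q.2.1 n)) ?_ (1 / (N : ℝ))
    exact Finset.measurable_sum _ fun n _ => hr.measurable_lossHessian.comp
      (f := fun q : a.Task × (Fin N → a.Data) × Param M => (q.1, q.2.2, q.2.1 n)) (by fun_prop)
  simp only [sampleMetaGradient, hr.gradient_batchLoss, hr.hessian_batchLoss]
  have h1 : Measurable fun q : a.Sample Nin Nout × Param M =>
      ContinuousLinearMap.id ℝ (Param M)
        - α • (1 / (Nin : ℝ)) • ∑ n, a.lossHessian q.1.1 q.2 (q.1.2.1 n) :=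
    (((hh Nin).comp (f := fun q : a.Sample Nin Nout × Param M => (q.1.1, q.1.2.1, q.2))
      (by fun_prop)).const_smul α).const_sub _
  have h2 : Measurable fun q : a.Sample Nin Nout × Param M =>
      q.2 - α • (1 / (Nin : ℝ)) • ∑ n, a.lossGradient q.1.1 q.2 (q.1.2.1 n) :=
    measurable_snd.sub (((hg Nin).comp
      (f := fun q : a.Sample Nin Nout × Param M => (q.1.1, q.1.2.1, q.2))
      (by fun_prop)).const_smul α)
  have h3 := (hg Nout).comp (f := fun q : a.Sample Nin Nout × Param M => (q.1.1, q.1.2.2,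
      q.2 - α • (1 / (Nin : ℝ)) • ∑ n, a.lossGradient q.1.1 q.2 (q.1.2.1 n)))
    (Measurable.prodMk (by fun_prop) (Measurable.prodMk (by fun_prop) h2))
  have happ : Continuous fun r : (Param M →L[ℝ] Param M) × Param M => r.1 r.2 :=
    isBoundedBilinearMap_apply.continuous
  exact happ.measurable.comp (h1.prodMk h3)

theorem Regular.measurable_sampleMetaGradient_sample (hr : a.Regular) {Nin Nout : ℕ} (α : ℝ)
    (p : Param M) :
    Measurable fun s : a.Sample Nin Nout => a.sampleMetaGradient α s p :=
  (hr.measurable_sampleMetaGradient α).comp (f := fun s : a.Sample Nin Nout => (s, p))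
    (by fun_prop)

theorem Regular.measurable_stochasticMetaGradient (hr : a.Regular) {Nin Nout S : ℕ} (α : ℝ) :
    Measurable fun q : (Fin S → a.Sample Nin Nout) × Param M =>
      a.stochasticMetaGradient α q.1 q.2 := by
  refine Measurable.const_smul (g := fun q : (Fin S → a.Sample Nin Nout) × Param M =>
      ∑ j, a.sampleMetaGradient α (q.1 j) q.2) ?_ (1 / (S : ℝ))
  exact Finset.measurable_sum _ fun j _ => (hr.measurable_sampleMetaGradient α).comp
      (f := fun q : (Fin S → a.Sample Nin Nout) × Param M => (q.1 j, q.2)) (by fun_prop)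

section Noise

variable {L B σG σH : ℝ} (hr : a.Regular) (hL : a.LipschitzGradients L) (hL0 : 0 ≤ L)
  (hB : a.BoundedGradients B) (hN : a.BoundedNoiseMoments σG σH)

include hr hN in
theorem memLp_gradient_noise (t : a.Task) (p : Param M) :
    MemLp (fun x => a.lossGradient t p x - gradient (a.risk t) p) 4 (a.dataLaw t) ∧
    ∫ x, ‖a.lossGradient t p x - gradient (a.risk t) p‖ ^ 2 ∂(a.dataLaw t) ≤ σG ^ 2 := by
  obtain ⟨hi, hle⟩ := (hN t p).1
  have hm := ((hr.measurable_lossGradient_data t p).sub_const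
    (gradient (a.risk t) p)).aestronglyMeasurable (μ := a.dataLaw t)
  refine ⟨(memLp_four_iff hm).2 hi, (integral_le_of_integral_sq_le (fun x => by positivity)
    (sq_nonneg _) ?_ ?_).2⟩
  · simpa only [← pow_mul] using hi
  · simpa only [← pow_mul] using hle

include hr hN in
theorem memLp_hessian_noise (t : a.Task) (p : Param M) :
    MemLp (fun x => a.lossHessian t p x - hessian (a.risk t) p) 4 (a.dataLaw t) ∧
    ∫ x, ‖a.lossHessian t p x - hessian (a.risk t) p‖ ^ 2 ∂(a.dataLaw t) ≤ σH ^ 2 := by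
  obtain ⟨hi, hle⟩ := (hN t p).2
  have hm := ((hr.measurable_lossHessian_data t p).sub_const
    (hessian (a.risk t) p)).aestronglyMeasurable (μ := a.dataLaw t)
  refine ⟨(memLp_four_iff hm).2 hi, (integral_le_of_integral_sq_le (fun x => by positivity)
    (sq_nonneg _) ?_ ?_).2⟩
  · simpa only [← pow_mul] using hi
  · simpa only [← pow_mul] using hle

include hr hL hB in
theorem integral_gradient_noise (t : a.Task) (p : Param M) :
    ∫ x, (a.lossGradient t p x - gradient (a.risk t) p) ∂(a.dataLaw t) = 0 := by
  rw [integral_sub (integrable_lossGradient hr hB t p) (integrable_const _),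
    gradient_risk hr hL hB]
  simp

theorem average_sub_const {E : Type*} [AddCommGroup E] [Module ℝ E] {N : ℕ} (hN : 0 < N)
    (f : Fin N → E) (c : E) :
    (1 / (N : ℝ)) • ∑ n, f n - c = (1 / (N : ℝ)) • ∑ n, (f n - c) := by
  have hN' : (N : ℝ) ≠ 0 := by exact_mod_cast hN.ne'
  rw [Finset.sum_sub_distrib, smul_sub]
  simp [← Nat.cast_smul_eq_nsmul ℝ, smul_smul, hN']

include hr hL hB hN in
theorem batchGradient_noise_moments (t : a.Task) (p : Param M) {N : ℕ} (hN0 : 0 < N) :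
    MemLp (fun χ : Fin N → a.Data => gradient (a.batchLoss t χ) p - gradient (a.risk t) p) 4
      (Measure.pi fun _ => a.dataLaw t) ∧
    ∫ χ : Fin N → a.Data, ‖gradient (a.batchLoss t χ) p - gradient (a.risk t) p‖ ^ 2
      ∂(Measure.pi fun _ => a.dataLaw t) ≤ σG ^ 2 / N ∧
    ∫ χ : Fin N → a.Data, ‖gradient (a.batchLoss t χ) p - gradient (a.risk t) p‖ ^ 4
      ∂(Measure.pi fun _ => a.dataLaw t) ≤ 3 * σG ^ 4 / N ^ 2 := by
  obtain ⟨h4, h2⟩ := memLp_gradient_noise hr hN t p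
  have h0 := integral_gradient_noise hr hL hB t p
  simp only [hr.gradient_batchLoss, average_sub_const hN0]
  refine ⟨memLp_average_pi h4 N, ?_, ?_⟩
  · rw [integral_norm_average_sq_pi (h4.mono_exponent (by norm_num)) h0 hN0]
    gcongr
  · have := integral_norm_average_pow_four_pi_le h4 h0 h2
      (by simpa only [← pow_mul] using (hN t p).1.2) hN0
    simpa only [← pow_mul] using this

include hr hB in
theorem integral_norm_batchGradient_le (t : a.Task) (p : Param M) {N : ℕ} (hN0 : 0 < N) :
    Integrable (fun χ : Fin N → a.Data => ‖gradient (a.batchLoss t χ) p‖)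
      (Measure.pi fun _ => a.dataLaw t) ∧
    ∫ χ : Fin N → a.Data, ‖gradient (a.batchLoss t χ) p‖
      ∂(Measure.pi fun _ => a.dataLaw t) ≤ B := by
  have hi := integrable_lossGradient hr hB t p
  have hint : Integrable (fun χ : Fin N → a.Data => gradient (a.batchLoss t χ) p)
      (Measure.pi fun _ => a.dataLaw t) := by
    simp only [hr.gradient_batchLoss]
    exact integrable_average_pi hi N
  refine ⟨hint.norm, ?_⟩
  have hav : Integrable (fun χ : Fin N → a.Data => (1 / (N : ℝ)) • ∑ n, ‖a.lossGradient t p (χ n)‖)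
      (Measure.pi fun _ => a.dataLaw t) :=
    integrable_average_pi hi.norm N
  refine (integral_mono hint.norm hav fun χ => ?_).trans
    ((integral_average_pi hi.norm hN0).trans_le (hB t p).2)
  simp only [hr.gradient_batchLoss, norm_smul, smul_eq_mul]
  rw [Real.norm_of_nonneg (by positivity)]
  gcongr
  exact norm_sum_le _ _

include hr hL hL0 hB hN in
-- Evaluation at a fixed vector `e` moves the Hessian noise into Euclidean space, where the variance
-- of an average gains the factor `1 / N`; this is not available for the operator norm.
theorem batchHessian_noise_apply (t : a.Task) (p e : Param M) {N : ℕ} (hN0 : 0 < N) :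
    Integrable (fun χ : Fin N → a.Data =>
      ‖(hessian (a.batchLoss t χ) p - hessian (a.risk t) p) e‖ ^ 2)
      (Measure.pi fun _ => a.dataLaw t) ∧
    ∫ χ : Fin N → a.Data, ‖(hessian (a.batchLoss t χ) p - hessian (a.risk t) p) e‖ ^ 2
      ∂(Measure.pi fun _ => a.dataLaw t) ≤ σH ^ 2 * ‖e‖ ^ 2 / N := by
  obtain ⟨h4, h2⟩ := memLp_hessian_noise hr hN t p
  have hm2 := h4.mono_exponent (p := 2) (by norm_num)
  have hHi := (memLp_lossHessian hr hL hL0 t p).1.integrable one_le_two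
  have hme : MemLp (fun x => (a.lossHessian t p x - hessian (a.risk t) p) e) 2 (a.dataLaw t) :=
    (hm2.continuousLinearMap_comp (ContinuousLinearMap.apply ℝ (Param M) e))
  have h0 : ∫ x, (a.lossHessian t p x - hessian (a.risk t) p) e ∂(a.dataLaw t) = 0 := by
    rw [← ContinuousLinearMap.integral_apply (hm2.integrable one_le_two),
      integral_sub hHi (integrable_const _), hessian_risk hr hL hL0 hB]
    simp
  have hrep : ∀ χ : Fin N → a.Data, (hessian (a.batchLoss t χ) p - hessian (a.risk t) p) e
      = (1 / (N : ℝ)) • ∑ n, (a.lossHessian t p (χ n) - hessian (a.risk t) p) e := by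
    intro χ
    rw [hr.hessian_batchLoss, average_sub_const hN0]
    simp
  simp only [hrep]
  have hav := memLp_average_pi hme N
  refine ⟨(memLp_two_iff_integrable_sq_norm hav.1).1 hav, ?_⟩
  rw [integral_norm_average_sq_pi hme h0 hN0]
  gcongr
  have hb : ∀ x, ‖(a.lossHessian t p x - hessian (a.risk t) p) e‖ ^ 2
      ≤ ‖a.lossHessian t p x - hessian (a.risk t) p‖ ^ 2 * ‖e‖ ^ 2 := fun x => by
    rw [← mul_pow]
    gcongr
    exact ContinuousLinearMap.le_opNorm _ _
  refine (integral_mono ((memLp_two_iff_integrable_sq_norm hme.1).1 hme)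
    (((memLp_two_iff_integrable_sq_norm hm2.1).1 hm2).mul_const _) hb).trans ?_
  rw [integral_mul_const]
  gcongr

/-- The average of the norms of the Hessians of the loss over a batch. -/
noncomputable def meanHessianNorm (a : Agent.{u, v} M) (t : a.Task) (p : Param M) {N : ℕ}
    (χ : Fin N → a.Data) : ℝ :=
  (1 / (N : ℝ)) * ∑ n, ‖a.lossHessian t p (χ n)‖

theorem meanHessianNorm_nonneg (t : a.Task) (p : Param M) {N : ℕ} (χ : Fin N → a.Data) :
    0 ≤ a.meanHessianNorm t p χ := by
  unfold meanHessianNorm; positivity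

include hr in
theorem norm_id_sub_batchHessian_le {α : ℝ} (hα : 0 ≤ α) (t : a.Task) (p : Param M) {N : ℕ}
    (χ : Fin N → a.Data) :
    ‖ContinuousLinearMap.id ℝ (Param M) - α • hessian (a.batchLoss t χ) p‖
      ≤ 1 + α * a.meanHessianNorm t p χ := by
  refine (norm_sub_le _ _).trans (add_le_add ContinuousLinearMap.norm_id_le ?_)
  rw [norm_smul, Real.norm_of_nonneg hα, hr.hessian_batchLoss, norm_smul,
    Real.norm_of_nonneg (by positivity), meanHessianNorm]
  gcongr
  exact norm_sum_le _ _

include hr hL hL0 in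
theorem integral_one_add_meanHessianNorm {α : ℝ} (hα : 0 ≤ α) (t : a.Task) (p : Param M) {N : ℕ}
    (hN0 : 0 < N) :
    Integrable (fun χ : Fin N → a.Data => 1 + α * a.meanHessianNorm t p χ)
      (Measure.pi fun _ => a.dataLaw t) ∧
    ∫ χ : Fin N → a.Data, (1 + α * a.meanHessianNorm t p χ) ∂(Measure.pi fun _ => a.dataLaw t)
      ≤ 1 + α * L ∧
    Integrable (fun χ : Fin N → a.Data => (1 + α * a.meanHessianNorm t p χ) ^ 2)
      (Measure.pi fun _ => a.dataLaw t) ∧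
    ∫ χ : Fin N → a.Data, (1 + α * a.meanHessianNorm t p χ) ^ 2
      ∂(Measure.pi fun _ => a.dataLaw t) ≤ (1 + α * L) ^ 2 := by
  obtain ⟨hm, hsq, hle⟩ := memLp_lossHessian hr hL hL0 t p
  have hN' : (0 : ℝ) < N := by exact_mod_cast hN0
  have hav : MemLp (a.meanHessianNorm t p (N := N)) 2 (Measure.pi fun _ => a.dataLaw t) :=
    memLp_average_pi hm.norm N
  have hint := hav.integrable one_le_two
  have hint2 := (memLp_two_iff_integrable_sq hav.1).1 hav
  have h1 : ∫ χ : Fin N → a.Data, a.meanHessianNorm t p χ ∂(Measure.pi fun _ => a.dataLaw t)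
      ≤ L := (integral_average_pi (hm.integrable one_le_two).norm hN0).trans_le hle
  have hn2 := (memLp_two_iff_integrable_sq_norm hm.1).1 hm
  have h2 : ∫ χ : Fin N → a.Data, a.meanHessianNorm t p χ ^ 2
      ∂(Measure.pi fun _ => a.dataLaw t) ≤ L ^ 2 := by
    refine (integral_mono hint2 (integrable_average_pi hn2 N) fun χ => ?_).trans
      ((integral_average_pi hn2 hN0).trans_le hsq)
    have := sq_sum_le_card_mul_sum_sq (s := (Finset.univ : Finset (Fin N)))
      (f := fun n => ‖a.lossHessian t p (χ n)‖)
    simp only [meanHessianNorm, smul_eq_mul, mul_pow]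
    rw [Finset.card_univ, Fintype.card_fin] at this
    calc (1 / (N : ℝ)) ^ 2 * (∑ n, ‖a.lossHessian t p (χ n)‖) ^ 2
        ≤ (1 / (N : ℝ)) ^ 2 * (N * ∑ n, ‖a.lossHessian t p (χ n)‖ ^ 2) := by gcongr
      _ = 1 / (N : ℝ) * ∑ n, ‖a.lossHessian t p (χ n)‖ ^ 2 := by field_simp
  have i1 : Integrable (fun χ : Fin N → a.Data => 1 + α * a.meanHessianNorm t p χ)
      (Measure.pi fun _ => a.dataLaw t) := (integrable_const 1).add (hint.const_mul α)
  have hexp : ∀ χ : Fin N → a.Data, (1 + α * a.meanHessianNorm t p χ) ^ 2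
      = 1 + (2 * α * a.meanHessianNorm t p χ + α ^ 2 * a.meanHessianNorm t p χ ^ 2) :=
    fun χ => by ring
  have j1 := hint.const_mul (2 * α)
  have j2 := hint2.const_mul (α ^ 2)
  refine ⟨i1, ?_, ?_, ?_⟩
  · rw [integral_add (integrable_const _) (hint.const_mul α), integral_const_mul]
    simp only [integral_const, probReal_univ, one_smul]
    gcongr
  · simp only [hexp]
    exact (integrable_const 1).add (j1.add j2)
  · simp only [hexp]
    rw [integral_add (integrable_const _) (j1.fun_add j2), integral_add j1 j2, integral_const_mul,
      integral_const_mul]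
    simp only [integral_const, probReal_univ, one_smul]
    have e1 := mul_le_mul_of_nonneg_left h1 (by positivity : 0 ≤ 2 * α)
    have e2 := mul_le_mul_of_nonneg_left h2 (by positivity : 0 ≤ α ^ 2)
    nlinarith

include hr hL hL0 hN in
/-- The fluctuations of the mean Hessian norm of a batch about its expectation, which is at most
`L`, have a fourth moment of order `N⁻²`. -/
theorem exists_meanHessianNorm_fluctuation (t : a.Task) (p : Param M) {N : ℕ} (hN0 : 0 < N) :
    ∃ r : ℝ, 0 ≤ r ∧ r ≤ L ∧
    Integrable (fun χ : Fin N → a.Data => (a.meanHessianNorm t p χ - r) ^ 4)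
      (Measure.pi fun _ => a.dataLaw t) ∧
    ∫ χ : Fin N → a.Data, (a.meanHessianNorm t p χ - r) ^ 4
      ∂(Measure.pi fun _ => a.dataLaw t) ≤ 9 * σH ^ 4 / N ^ 2 := by
  obtain ⟨hm, hsq, hle⟩ := memLp_lossHessian hr hL hL0 t p
  obtain ⟨h4, h2⟩ := memLp_hessian_noise hr hN t p
  have hi4 := (memLp_four_iff h4.1).1 h4
  have hi := (hm.integrable one_le_two).norm
  set r := ∫ x, ‖a.lossHessian t p x‖ ∂(a.dataLaw t) with hrdef
  have hr0 : 0 ≤ r := integral_nonneg fun x => norm_nonneg _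
  set h : ℝ := ‖hessian (a.risk t) p‖ with hh
  have hZb : ∀ x, |‖a.lossHessian t p x‖ - h| ≤ ‖a.lossHessian t p x - hessian (a.risk t) p‖ :=
    fun x => abs_norm_sub_norm_le _ _
  have hmeas : AEStronglyMeasurable (fun x => ‖a.lossHessian t p x‖ - h) (a.dataLaw t) :=
    hi.1.sub aestronglyMeasurable_const
  have hZ : MemLp (fun x => ‖a.lossHessian t p x‖ - h) 4 (a.dataLaw t) :=
    h4.mono hmeas (ae_of_all _ hZb)
  have hZmean : ∫ x, (‖a.lossHessian t p x‖ - h) ∂(a.dataLaw t) = r - h := by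
    rw [integral_sub hi (integrable_const _)]; simp [hrdef]
  have hZ4 : ∫ x, (‖a.lossHessian t p x‖ - h) ^ 4 ∂(a.dataLaw t) ≤ σH ^ 4 := by
    have hZi := (memLp_four_iff hZ.1).1 hZ
    simp only [Real.norm_eq_abs, Even.pow_abs (show Even 4 by decide)] at hZi
    refine (integral_mono hZi hi4 fun x => ?_).trans (hN t p).2.2
    rw [← Even.pow_abs (show Even 4 by decide)]
    exact pow_le_pow_left₀ (abs_nonneg _) (hZb x) 4
  -- The hypothesis controls the Hessian norm about `‖∇²J‖`, whereas averaging requires centring at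
  -- its own mean `r`; moving the centre costs a factor `3`.
  have hc4 : ∫ x, (‖a.lossHessian t p x‖ - r) ^ 4 ∂(a.dataLaw t) ≤ 3 * σH ^ 4 := by
    have := integral_sub_integral_pow_four_le hZ
    rw [hZmean] at this
    simp only [sub_sub_sub_cancel_right] at this
    linarith
  have hc : MemLp (fun x => ‖a.lossHessian t p x‖ - r) 4 (a.dataLaw t) := by
    have := hZ.sub (memLp_const (r - h))
    refine this.ae_eq (ae_of_all _ fun x => ?_)
    simp
  have hc0 : ∫ x, (‖a.lossHessian t p x‖ - r) ∂(a.dataLaw t) = 0 := by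
    rw [integral_sub hi (integrable_const _)]; simp [hrdef]
  -- `√3 * σH ^ 2` plays the role of `T` in the fourth-moment bound, whose own factor `3` then gives
  -- `9 = 3 * 3`.
  have hT : (√3 * σH ^ 2) ^ 2 = 3 * σH ^ 4 := by
    rw [mul_pow, Real.sq_sqrt (by norm_num)]; ring
  have hc4' : ∫ x, ‖‖a.lossHessian t p x‖ - r‖ ^ 4 ∂(a.dataLaw t) ≤ (√3 * σH ^ 2) ^ 2 := by
    simp only [Real.norm_eq_abs, Even.pow_abs (show Even 4 by decide)]
    rwa [hT]
  have hc2 : ∫ x, ‖‖a.lossHessian t p x‖ - r‖ ^ 2 ∂(a.dataLaw t) ≤ √3 * σH ^ 2 := by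
    refine (integral_le_of_integral_sq_le (fun x => by positivity) (by positivity) ?_ ?_).2
    · simpa only [← pow_mul] using (memLp_four_iff hc.1).1 hc
    · simpa only [← pow_mul] using hc4'
  have hrep : ∀ χ : Fin N → a.Data, a.meanHessianNorm t p χ - r
      = (1 / (N : ℝ)) • ∑ n, (‖a.lossHessian t p (χ n)‖ - r) := fun χ => by
    rw [← average_sub_const hN0]; rfl
  have hav := memLp_average_pi hc N
  have e1 := (memLp_four_iff hav.1).1 hav
  have e2 := integral_norm_average_pow_four_pi_le hc hc0 hc2 hc4' hN0
  simp only [Real.norm_eq_abs, Even.pow_abs (show Even 4 by decide)] at e1 e2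
  refine ⟨r, hr0, hle, ?_, ?_⟩
  · simpa only [hrep] using e1
  · simp only [hrep]
    refine e2.trans (le_of_eq ?_)
    rw [hT]; ring

end Noise

end Agent

/-! ### Second moment of the stochastic MAML gradient -/

namespace Agent

variable {M : ℕ} {a : Agent.{u, v} M}

section SampleBound

variable {α L B σG σH γG γH : ℝ} (hr : a.Regular) (hL : a.LipschitzGradients L) (hL0 : 0 ≤ L)
  (hB : a.BoundedGradients B) (hN : a.BoundedNoiseMoments σG σH)
  (hT : a.BoundedTaskVariability γG γH) (hα : 0 ≤ α)

/-- The exact MAML gradient of a risk `f`, `(I - α ∇²f(p)) ∇f(p - α ∇f(p))`. -/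
noncomputable def metaGradient (α : ℝ) (f : Param M → ℝ) (p : Param M) : Param M :=
  (ContinuousLinearMap.id ℝ (Param M) - α • hessian f p) (gradient f (p - α • gradient f p))

/-- The part of the mean squared error of a sampled MAML gradient that stems from the inner batch,
together with the conditional error of the outer batch. -/
noncomputable def innerError (a : Agent.{u, v} M) (α L σG : ℝ) (Nout : ℕ) (r : ℝ) (t : a.Task)
    (p : Param M) {N : ℕ} (χ : Fin N → a.Data) : ℝ :=
  (1 + α * a.meanHessianNorm t p χ) ^ 2 * (σG ^ 2 / Nout)
    + 2 * (1 + α * L) ^ 2 * (L ^ 2 * α ^ 2)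
      * ‖gradient (a.batchLoss t χ) p - gradient (a.risk t) p‖ ^ 2
    + α ^ 4 * (3 / 4 * (a.meanHessianNorm t p χ - r) ^ 4
      + 4 / 3 * L ^ 4 * ‖gradient (a.batchLoss t χ) p - gradient (a.risk t) p‖ ^ 4)
    + α ^ 2 * ‖(hessian (a.batchLoss t χ) p - hessian (a.risk t) p)
        (gradient (a.risk t) (p - α • gradient (a.risk t) p))‖ ^ 2

include hr hL hL0 hB hN hα in
theorem integral_innerError_le (t : a.Task) (p : Param M) {Nin Nout : ℕ} (hNin : 0 < Nin) {r : ℝ}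
    (hri : Integrable (fun χ : Fin Nin → a.Data => (a.meanHessianNorm t p χ - r) ^ 4)
      (Measure.pi fun _ => a.dataLaw t))
    (hrle : ∫ χ : Fin Nin → a.Data, (a.meanHessianNorm t p χ - r) ^ 4
      ∂(Measure.pi fun _ => a.dataLaw t) ≤ 9 * σH ^ 4 / Nin ^ 2) :
    Integrable (a.innerError α L σG Nout r t p (N := Nin)) (Measure.pi fun _ => a.dataLaw t) ∧
    ∫ χ : Fin Nin → a.Data, a.innerError α L σG Nout r t p χ ∂(Measure.pi fun _ => a.dataLaw t)
      ≤ (1 + α * L) ^ 2 * (σG ^ 2 / Nout)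
        + 2 * (1 + α * L) ^ 2 * (L ^ 2 * α ^ 2) * (σG ^ 2 / Nin)
        + α ^ 4 * (3 / 4 * (9 * σH ^ 4 / Nin ^ 2) + 4 / 3 * L ^ 4 * (3 * σG ^ 4 / Nin ^ 2))
        + α ^ 2 * (σH ^ 2 * B ^ 2 / Nin) := by
  obtain ⟨-, -, h1i, h1⟩ := integral_one_add_meanHessianNorm hr hL hL0 hα t p hNin
  obtain ⟨hg, hg2, hg4⟩ := batchGradient_noise_moments hr hL hB hN t p hNin
  obtain ⟨hhi, hh⟩ := batchHessian_noise_apply hr hL hL0 hB hN t p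
    (gradient (a.risk t) (p - α • gradient (a.risk t) p)) hNin
  have hg4i := (memLp_four_iff hg.1).1 hg
  have hg2i := (memLp_two_iff_integrable_sq_norm hg.1).1 (hg.mono_exponent (by norm_num))
  have hu := norm_gradient_risk_le hr hL hB t (p - α • gradient (a.risk t) p)
  have i1 := h1i.mul_const (σG ^ 2 / (Nout : ℝ))
  have i2 := hg2i.const_mul (2 * (1 + α * L) ^ 2 * (L ^ 2 * α ^ 2))
  have i3a := hri.const_mul (3 / 4)
  have i3b := hg4i.const_mul (4 / 3 * L ^ 4)
  have i3 := (i3a.fun_add i3b).const_mul (α ^ 4)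
  have i4 := hhi.const_mul (α ^ 2)
  refine ⟨((i1.add i2).add i3).add i4, ?_⟩
  unfold innerError
  rw [integral_add ((i1.fun_add i2).fun_add i3) i4, integral_add (i1.fun_add i2) i3,
    integral_add i1 i2, integral_mul_const, integral_const_mul, integral_const_mul,
    integral_add i3a i3b, integral_const_mul, integral_const_mul, integral_const_mul]
  have hB0 := hB.nonneg
  have hh' : σH ^ 2 * ‖gradient (a.risk t) (p - α • gradient (a.risk t) p)‖ ^ 2 / (Nin : ℝ)
      ≤ σH ^ 2 * B ^ 2 / Nin := by gcongr
  gcongr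
  exact hh.trans hh'

include hr hL hL0 hB hα in
-- A pathwise four-term splitting. The outer-batch noise appears explicitly in the first term, so
-- `innerError` is taken with `0` for `σG`, which removes the averaged version of that noise.
theorem norm_sampleMetaGradient_sub_sq_le (c : Param M) {Nin Nout : ℕ} (t : a.Task)
    (χ : Fin Nin → a.Data) (χ' : Fin Nout → a.Data) (p : Param M) {r : ℝ} (hr0 : 0 ≤ r)
    (hrL : r ≤ L) :
    ‖a.sampleMetaGradient α (t, χ, χ') p - c‖ ^ 2
      ≤ 4 * ((1 + α * a.meanHessianNorm t p χ) ^ 2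
          * ‖gradient (a.batchLoss t χ') (p - α • gradient (a.batchLoss t χ) p)
            - gradient (a.risk t) (p - α • gradient (a.batchLoss t χ) p)‖ ^ 2
        + a.innerError α L 0 Nout r t p χ + ‖metaGradient α (a.risk t) p - c‖ ^ 2) := by
  have hαL : 0 ≤ α * L := mul_nonneg hα hL0
  set h := a.meanHessianNorm t p χ with hhdef
  have hh0 : 0 ≤ h := meanHessianNorm_nonneg t p χ
  set δg := gradient (a.batchLoss t χ) p - gradient (a.risk t) p with hδg
  set q := p - α • gradient (a.batchLoss t χ) p with hq
  set q₀ := p - α • gradient (a.risk t) p with hq₀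
  set Tin := ContinuousLinearMap.id ℝ (Param M) - α • hessian (a.batchLoss t χ) p with hTin
  have hTle : ‖Tin‖ ≤ 1 + α * h := norm_id_sub_batchHessian_le hr hα t p χ
  set x₁ := Tin (gradient (a.batchLoss t χ') q - gradient (a.risk t) q) with hx₁
  set x₂ := Tin (gradient (a.risk t) q - gradient (a.risk t) q₀) with hx₂
  set x₃ := -(α • (hessian (a.batchLoss t χ) p - hessian (a.risk t) p) (gradient (a.risk t) q₀))
    with hx₃
  set x₄ := metaGradient α (a.risk t) p - c with hx₄
  -- The gradient of the risk is compared at the random point `q` and at `q₀`, which depends on the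
  -- task only. The Hessian noise in `x₃` thereby acts on a vector independent of the inner batch.
  have hsplit : a.sampleMetaGradient α (t, χ, χ') p - c = x₁ + x₂ + x₃ + x₄ := by
    simp only [sampleMetaGradient, metaGradient, hx₁, hx₂, hx₃, hx₄, hTin, ← hq, ← hq₀, map_sub,
      sub_apply, smul_apply,
      ContinuousLinearMap.id_apply]
    module
  have e1 : ‖x₁‖ ^ 2 ≤ (1 + α * h) ^ 2
      * ‖gradient (a.batchLoss t χ') q - gradient (a.risk t) q‖ ^ 2 := by
    rw [← mul_pow]
    gcongr
    exact Tin.le_of_opNorm_le hTle _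
  have hη : ‖gradient (a.risk t) q - gradient (a.risk t) q₀‖ ≤ L * α * ‖δg‖ := by
    refine (norm_gradient_risk_sub_le hr hL hL0 hB t q q₀).trans (le_of_eq ?_)
    have : q - q₀ = -(α • δg) := by rw [hq, hq₀, hδg]; module
    rw [this, norm_neg, norm_smul, Real.norm_of_nonneg hα]
    ring
  have e2 : ‖x₂‖ ^ 2 ≤ 2 * (1 + α * L) ^ 2 * (L ^ 2 * α ^ 2) * ‖δg‖ ^ 2
      + α ^ 4 * (3 / 4 * (h - r) ^ 4 + 4 / 3 * L ^ 4 * ‖δg‖ ^ 4) := by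
    have h1 : ‖x₂‖ ≤ (1 + α * h) * (L * α * ‖δg‖) :=
      (Tin.le_of_opNorm_le hTle _).trans (by gcongr)
    -- `h` and `δg` come from the same batch. Replacing `h` by the constant `r ≤ L` plus a
    -- fluctuation confines their dependence to a product of fluctuations.
    have h2 : (1 + α * h) ^ 2 ≤ 2 * (1 + α * L) ^ 2 + 2 * α ^ 2 * (h - r) ^ 2 := by
      have h3 : (1 + α * h) ^ 2 ≤ 2 * (1 + α * r) ^ 2 + 2 * (α * (h - r)) ^ 2 := by
        nlinarith [sq_nonneg ((1 + α * r) - α * (h - r))]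
      have h4 : (1 + α * r) ^ 2 ≤ (1 + α * L) ^ 2 := by gcongr
      nlinarith
    calc ‖x₂‖ ^ 2 ≤ ((1 + α * h) * (L * α * ‖δg‖)) ^ 2 := by gcongr
      _ = (1 + α * h) ^ 2 * ((L * α) ^ 2 * ‖δg‖ ^ 2) := by ring
      _ ≤ (2 * (1 + α * L) ^ 2 + 2 * α ^ 2 * (h - r) ^ 2) * ((L * α) ^ 2 * ‖δg‖ ^ 2) := by gcongr
      _ = 2 * (1 + α * L) ^ 2 * (L ^ 2 * α ^ 2) * ‖δg‖ ^ 2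
          + α ^ 4 * (2 * (h - r) ^ 2 * (L ^ 2 * ‖δg‖ ^ 2)) := by ring
      _ ≤ _ := by
        gcongr
        -- Young's inequality `2 x y ≤ 3/4 x² + 4/3 y²`. The weight `3/4` is fitted to `C1sq`: with
        -- the factor `4` of the splitting and the moment `9 * σH ^ 4` it gives exactly `27 = 3 *
        -- 9`.
        nlinarith [sq_nonneg (3 / 4 * (h - r) ^ 2 - L ^ 2 * ‖δg‖ ^ 2)]
  have e3 : ‖x₃‖ ^ 2 = α ^ 2 * ‖(hessian (a.batchLoss t χ) p - hessian (a.risk t) p)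
        (gradient (a.risk t) q₀)‖ ^ 2 := by
    rw [hx₃, norm_neg, norm_smul, Real.norm_of_nonneg hα, mul_pow]
  rw [hsplit]
  refine (norm_add_four_sq_le x₁ x₂ x₃ x₄).trans ?_
  unfold innerError
  rw [e3, ← hhdef, ← hδg, ← hq₀]
  simp only [ne_eq, OfNat.ofNat_ne_zero, not_false_eq_true, zero_pow, zero_div, mul_zero, zero_add]
  linarith

include hr hL hL0 hB hT hα in
-- The task risk is compared with the mean risk at `q₀`, which does not depend on the task, since
-- the variability hypotheses concern fixed parameters. An integrable majorant `V` is produced so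
-- that integrability of the exact MAML gradient in the task is not needed.
theorem exists_metaGradient_variability_bound (p : Param M) :
    ∃ V : a.Task → ℝ, Integrable V a.taskLaw ∧
    (∀ t, ‖metaGradient α (a.risk t) p - metaGradient α a.meanRisk p‖ ^ 2 ≤ V t) ∧
    ∫ t, V t ∂a.taskLaw
      ≤ 4 * (1 + α * L) ^ 2 * (1 + α ^ 2 * L ^ 2) * γG ^ 2 + 2 * B ^ 2 * α ^ 2 * γH ^ 2 := by
  have hαL : 0 ≤ α * L := mul_nonneg hα hL0
  have hG : ∀ q : Param M,
      Integrable (fun t => ‖gradient (a.risk t) q - gradient a.meanRisk q‖ ^ 2) a.taskLaw ∧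
      ∫ t, ‖gradient (a.risk t) q - gradient a.meanRisk q‖ ^ 2 ∂a.taskLaw ≤ γG ^ 2 := fun q =>
    integral_le_of_integral_sq_le (fun t => by positivity) (sq_nonneg _)
      (by simpa only [← pow_mul] using (hT q).1.1) (by simpa only [← pow_mul] using (hT q).1.2)
  have hH : Integrable (fun t => ‖hessian (a.risk t) p - hessian a.meanRisk p‖ ^ 2) a.taskLaw ∧
      ∫ t, ‖hessian (a.risk t) p - hessian a.meanRisk p‖ ^ 2 ∂a.taskLaw ≤ γH ^ 2 :=
    integral_le_of_integral_sq_le (fun t => by positivity) (sq_nonneg _)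
      (by simpa only [← pow_mul] using (hT p).2.1) (by simpa only [← pow_mul] using (hT p).2.2)
  set G := gradient a.meanRisk p with hGdef
  set q₀ := p - α • G with hq₀
  have i1 := (hG p).1.const_mul (α ^ 2 * L ^ 2)
  have i2 := (i1.fun_add (hG q₀).1).const_mul (4 * (1 + α * L) ^ 2)
  have i3 := hH.1.const_mul (2 * B ^ 2 * α ^ 2)
  refine ⟨_, i2.fun_add i3, fun t => ?_, ?_⟩
  · set T := ContinuousLinearMap.id ℝ (Param M) - α • hessian (a.risk t) p with hTdef
    set q := p - α • gradient (a.risk t) p with hq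
    have hTle : ‖T‖ ≤ 1 + α * L := by
      refine (norm_sub_le _ _).trans (add_le_add ContinuousLinearMap.norm_id_le ?_)
      rw [norm_smul, Real.norm_of_nonneg hα]
      gcongr
      exact norm_hessian_risk_le hr hL hL0 hB t p
    have hsplit : metaGradient α (a.risk t) p - metaGradient α a.meanRisk p
        = T ((gradient (a.risk t) q - gradient (a.risk t) q₀)
            + (gradient (a.risk t) q₀ - gradient a.meanRisk q₀))
          + -(α • (hessian (a.risk t) p - hessian a.meanRisk p) (gradient a.meanRisk q₀)) := by
      simp only [metaGradient, hTdef, ← hq, ← hq₀, ← hGdef, map_sub, map_add,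
        sub_apply, smul_apply,
        ContinuousLinearMap.id_apply]
      module
    have hη : ‖gradient (a.risk t) q - gradient (a.risk t) q₀‖
        ≤ α * L * ‖gradient (a.risk t) p - G‖ := by
      refine (norm_gradient_risk_sub_le hr hL hL0 hB t q q₀).trans (le_of_eq ?_)
      have : q - q₀ = -(α • (gradient (a.risk t) p - G)) := by rw [hq, hq₀]; module
      rw [this, norm_neg, norm_smul, Real.norm_of_nonneg hα]
      ring
    set x := ‖gradient (a.risk t) p - G‖ with hx
    set y := ‖gradient (a.risk t) q₀ - gradient a.meanRisk q₀‖ with hy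
    set z := ‖hessian (a.risk t) p - hessian a.meanRisk p‖ with hz
    have e1 : ‖T ((gradient (a.risk t) q - gradient (a.risk t) q₀)
            + (gradient (a.risk t) q₀ - gradient a.meanRisk q₀))‖
        ≤ (1 + α * L) * (α * L * x + y) := by
      refine (T.le_of_opNorm_le hTle _).trans ?_
      gcongr
      exact (norm_add_le _ _).trans (by gcongr)
    have e2 : ‖-(α • (hessian (a.risk t) p - hessian a.meanRisk p) (gradient a.meanRisk q₀))‖
        ≤ α * (z * B) := by
      rw [norm_neg, norm_smul, Real.norm_of_nonneg hα]
      gcongr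
      refine (ContinuousLinearMap.le_opNorm _ _).trans ?_
      gcongr
      exact norm_gradient_meanRisk_le hr hL hB q₀
    have e3 := pow_le_pow_left₀ (norm_nonneg _) ((norm_add_le _ _).trans (add_le_add e1 e2)) 2
    rw [hsplit]
    refine e3.trans ?_
    have f1 : (α * L * x + y) ^ 2 ≤ 2 * (α ^ 2 * L ^ 2 * x ^ 2 + y ^ 2) := by
      nlinarith [sq_nonneg (α * L * x - y)]
    have f2 : (1 + α * L) ^ 2 * (α * L * x + y) ^ 2
        ≤ (1 + α * L) ^ 2 * (2 * (α ^ 2 * L ^ 2 * x ^ 2 + y ^ 2)) := by gcongr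
    nlinarith [sq_nonneg ((1 + α * L) * (α * L * x + y) - α * (z * B))]
  · rw [integral_add i2 i3, integral_const_mul, integral_add i1 (hG q₀).1, integral_const_mul,
      integral_const_mul]
    have f1 : α ^ 2 * L ^ 2 * ∫ t, ‖gradient (a.risk t) p - G‖ ^ 2 ∂a.taskLaw
        ≤ α ^ 2 * L ^ 2 * γG ^ 2 := by
      gcongr
      exact (hG p).2
    calc _ ≤ 4 * (1 + α * L) ^ 2 * (α ^ 2 * L ^ 2 * γG ^ 2 + γG ^ 2)
          + 2 * B ^ 2 * α ^ 2 * γH ^ 2 := by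
          gcongr
          · exact (hG q₀).2
          · exact hH.2
      _ = _ := by ring

theorem innerError_eq_add (σG : ℝ) (Nout : ℕ) (r : ℝ) (t : a.Task) (p : Param M) {N : ℕ}
    (χ : Fin N → a.Data) :
    a.innerError α L σG Nout r t p χ = (1 + α * a.meanHessianNorm t p χ) ^ 2 * (σG ^ 2 / Nout)
      + a.innerError α L 0 Nout r t p χ := by
  unfold innerError
  ring

theorem innerError_nonneg (σG : ℝ) (Nout : ℕ) (r : ℝ) (t : a.Task) (p : Param M) {N : ℕ}
    (χ : Fin N → a.Data) : 0 ≤ a.innerError α L σG Nout r t p χ := by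
  have h : 0 ≤ (a.meanHessianNorm t p χ - r) ^ 4 := Even.pow_nonneg (by decide) _
  unfold innerError
  positivity

include hr hL hL0 hB hN hα in
/-- The mean squared error of the sampled MAML gradient of a fixed task. -/
theorem lintegral_sampleMetaGradient_task_le (t : a.Task) (p c : Param M) {Nin Nout : ℕ}
    (hNin : 0 < Nin) (hNout : 0 < Nout) :
    ∫⁻ χ : Fin Nin → a.Data, ∫⁻ χ' : Fin Nout → a.Data,
        ENNReal.ofReal (‖a.sampleMetaGradient α (t, χ, χ') p - c‖ ^ 2)
        ∂(Measure.pi fun _ => a.dataLaw t) ∂(Measure.pi fun _ => a.dataLaw t)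
      ≤ ENNReal.ofReal (3 * C1sq α L B σG σH Nin Nout
        + 4 * ‖metaGradient α (a.risk t) p - c‖ ^ 2) := by
  obtain ⟨r, hr0, hrL, hri, hrle⟩ := exists_meanHessianNorm_fluctuation hr hL hL0 hN t p hNin
  obtain ⟨hi, hle⟩ := integral_innerError_le (Nout := Nout) hr hL hL0 hB hN hα t p hNin hri hrle
  set d := ‖metaGradient α (a.risk t) p - c‖ ^ 2 with hd
  have hd0 : 0 ≤ d := by positivity
  -- For a fixed inner batch the evaluation point of the outer gradient is deterministic, so
  -- averaging over the outer batch first contributes `σG ^ 2 / Nout`.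
  have houter : ∀ χ : Fin Nin → a.Data, ∫⁻ χ' : Fin Nout → a.Data,
        ENNReal.ofReal (‖a.sampleMetaGradient α (t, χ, χ') p - c‖ ^ 2)
        ∂(Measure.pi fun _ => a.dataLaw t)
      ≤ ENNReal.ofReal (4 * (a.innerError α L σG Nout r t p χ + d)) := by
    intro χ
    obtain ⟨hg, hg2, -⟩ := batchGradient_noise_moments hr hL hB hN t
      (p - α • gradient (a.batchLoss t χ) p) hNout
    have hgi := (memLp_two_iff_integrable_sq_norm hg.1).1 (hg.mono_exponent (by norm_num))
    have j1 := hgi.const_mul ((1 + α * a.meanHessianNorm t p χ) ^ 2)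
    have j2 := ((j1.add (integrable_const (a.innerError α L 0 Nout r t p χ))).add
      (integrable_const d)).const_mul 4
    refine (lintegral_mono fun χ' => ENNReal.ofReal_le_ofReal
      (norm_sampleMetaGradient_sub_sq_le hr hL hL0 hB hα c t χ χ' p hr0 hrL)).trans ?_
    have h0 := innerError_nonneg (α := α) (L := L) 0 Nout r t p χ
    refine lintegral_ofReal_le_of_integral_le (fun χ' => by positivity) j2 ?_
    rw [integral_const_mul, integral_add (j1.fun_add (integrable_const _)) (integrable_const _),
      integral_add j1 (integrable_const _), integral_const_mul, innerError_eq_add σG]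
    simp only [integral_const, probReal_univ, one_smul]
    gcongr
  refine (lintegral_mono houter).trans ?_
  have j := (hi.add (integrable_const d)).const_mul 4
  refine lintegral_ofReal_le_of_integral_le (fun χ => ?_) j ?_
  · have h0 := innerError_nonneg (α := α) (L := L) σG Nout r t p χ
    positivity
  rw [integral_const_mul, integral_add hi (integrable_const _)]
  simp only [integral_const, probReal_univ, one_smul]
  have hαL : 0 ≤ α * L := mul_nonneg hα hL0
  have hNin' : (0 : ℝ) < Nin := by exact_mod_cast hNin
  have hNout' : (0 : ℝ) < Nout := by exact_mod_cast hNout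
  -- The difference between `3 * C1sq` and four times the bound on the inner error, term by term;
  -- the `σH ^ 4` terms cancel exactly.
  have hC : 0 ≤ 14 * ((1 + α * L) ^ 2 * (σG ^ 2 / Nout))
      + 10 * ((1 + α * L) ^ 2 * (L ^ 2 * α ^ 2) * (σG ^ 2 / Nin))
      + 11 * (α ^ 4 * L ^ 4 * σG ^ 4 / Nin ^ 2) + 14 * (α ^ 2 * (σH ^ 2 * B ^ 2 / Nin))
      + 18 * α ^ 2 * σH ^ 2 / Nin * (σG ^ 2 / Nout) := by positivity
  have hC1 : 3 * C1sq α L B σG σH Nin Nout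
      = 4 * ((1 + α * L) ^ 2 * (σG ^ 2 / Nout)
        + 2 * (1 + α * L) ^ 2 * (L ^ 2 * α ^ 2) * (σG ^ 2 / Nin)
        + α ^ 4 * (3 / 4 * (9 * σH ^ 4 / Nin ^ 2) + 4 / 3 * L ^ 4 * (3 * σG ^ 4 / Nin ^ 2))
        + α ^ 2 * (σH ^ 2 * B ^ 2 / Nin))
      + (14 * ((1 + α * L) ^ 2 * (σG ^ 2 / Nout))
      + 10 * ((1 + α * L) ^ 2 * (L ^ 2 * α ^ 2) * (σG ^ 2 / Nin))
      + 11 * (α ^ 4 * L ^ 4 * σG ^ 4 / Nin ^ 2) + 14 * (α ^ 2 * (σH ^ 2 * B ^ 2 / Nin))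
      + 18 * α ^ 2 * σH ^ 2 / Nin * (σG ^ 2 / Nout)) := by
    unfold C1sq
    field_simp
    ring
  rw [hC1]
  linarith

theorem C1sq_nonneg (B σG σH : ℝ) (Nin Nout : ℕ) : 0 ≤ C1sq α L B σG σH Nin Nout := by
  unfold C1sq; positivity

include hr hL hL0 hB hN hT hα in
theorem integral_norm_sampleMetaGradient_sub_sq_le (p : Param M) {Nin Nout : ℕ}
    (hNin : 0 < Nin) (hNout : 0 < Nout) :
    MemLp (fun s : a.Sample Nin Nout => a.sampleMetaGradient α s p) 2 (a.sampleLaw Nin Nout) ∧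
    ∫ s : a.Sample Nin Nout, ‖a.sampleMetaGradient α s p - metaGradient α a.meanRisk p‖ ^ 2
      ∂(a.sampleLaw Nin Nout) ≤ 3 * (C1sq α L B σG σH Nin Nout + C2sq α L B γG γH) := by
  obtain ⟨V, hVi, hV, hVle⟩ := exists_metaGradient_variability_bound hr hL hL0 hB hT hα p
  have hαL : 0 ≤ α * L := mul_nonneg hα hL0
  have hm := hr.measurable_sampleMetaGradient_sample (Nin := Nin) (Nout := Nout) α p
  have hm' := hm.sub_const (metaGradient α a.meanRisk p)
  have hC1 := C1sq_nonneg (α := α) (L := L) B σG σH Nin Nout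
  have hC2 : 4 * (4 * (1 + α * L) ^ 2 * (1 + α ^ 2 * L ^ 2) * γG ^ 2 + 2 * B ^ 2 * α ^ 2 * γH ^ 2)
      ≤ 3 * C2sq α L B γG γH := by
    have : 0 ≤ 8 * ((1 + α * L) ^ 2 * (1 + α ^ 2 * L ^ 2) * γG ^ 2)
        + 4 * (B ^ 2 * α ^ 2 * γH ^ 2) + 6 * (α ^ 4 * γH ^ 4)
        + 48 * ((1 + α ^ 4 * L ^ 4) * γG ^ 4) := by positivity
    unfold C2sq
    linarith
  have hC20 : 0 ≤ C2sq α L B γG γH := by unfold C2sq; positivity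
  have hV0 : ∀ t, 0 ≤ V t := fun t => (sq_nonneg _).trans (hV t)
  have hbound : ∫⁻ s : a.Sample Nin Nout,
      ENNReal.ofReal (‖a.sampleMetaGradient α s p - metaGradient α a.meanRisk p‖ ^ 2)
      ∂(a.sampleLaw Nin Nout)
      ≤ ENNReal.ofReal (3 * (C1sq α L B σG σH Nin Nout + C2sq α L B γG γH)) := by
    rw [lintegral_sampleLaw (hm'.norm.pow_const 2).ennreal_ofReal]
    refine (lintegral_mono fun t => lintegral_sampleMetaGradient_task_le hr hL hL0 hB hN hα t p _
      hNin hNout).trans ?_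
    have hj := (integrable_const (3 * C1sq α L B σG σH Nin Nout)).fun_add (hVi.const_mul 4)
    refine (lintegral_mono fun t => ENNReal.ofReal_le_ofReal
      (add_le_add_right (mul_le_mul_of_nonneg_left (hV t) zero_le_four) _)).trans ?_
    refine lintegral_ofReal_le_of_integral_le (fun t => ?_) hj ?_
    · have := hV0 t
      positivity
    · rw [integral_add (integrable_const _) (hVi.const_mul 4), integral_const_mul (4 : ℝ) V]
      simp only [integral_const, probReal_univ, one_smul]
      linarith
  obtain ⟨hi, hle⟩ := integral_le_of_lintegral_ofReal_le (fun s => by positivity)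
    (hm'.norm.pow_const 2).aestronglyMeasurable (by positivity) hbound
  refine ⟨?_, hle⟩
  have h2 := ((memLp_two_iff_integrable_sq_norm hm'.aestronglyMeasurable).2 hi).add
    (memLp_const (metaGradient α a.meanRisk p))
  refine h2.ae_eq (ae_of_all _ fun s => ?_)
  simp

include hr hL hL0 hB hα in
-- Given the inner batch, the outer gradient has mean norm at most `B` wherever it is evaluated; the
-- remaining factor `1 + α h`, with `h` the mean Hessian norm, has expectation at most `1 + α * L`.
theorem integral_norm_sampleMetaGradient_le (p : Param M) {Nin Nout : ℕ}
    (hNin : 0 < Nin) (hNout : 0 < Nout) :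
    ∫ s : a.Sample Nin Nout, ‖a.sampleMetaGradient α s p‖ ∂(a.sampleLaw Nin Nout)
      ≤ Bhat α L B := by
  have hαL : 0 ≤ α * L := mul_nonneg hα hL0
  have hB0 := hB.nonneg
  have hm := hr.measurable_sampleMetaGradient_sample (Nin := Nin) (Nout := Nout) α p
  have hpt : ∀ t (χ : Fin Nin → a.Data), 0 ≤ 1 + α * a.meanHessianNorm t p χ := fun t χ => by
    have := meanHessianNorm_nonneg t p χ
    positivity
  refine (integral_le_of_lintegral_ofReal_le (fun s => norm_nonneg _)
    hm.norm.aestronglyMeasurable (by unfold Bhat; positivity) ?_).2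
  rw [lintegral_sampleLaw hm.norm.ennreal_ofReal]
  have htask : ∀ t, ∫⁻ χ : Fin Nin → a.Data, ∫⁻ χ' : Fin Nout → a.Data,
        ENNReal.ofReal ‖a.sampleMetaGradient α (t, χ, χ') p‖
        ∂(Measure.pi fun _ => a.dataLaw t) ∂(Measure.pi fun _ => a.dataLaw t)
      ≤ ENNReal.ofReal (Bhat α L B) := by
    intro t
    obtain ⟨h1i, h1, -, -⟩ := integral_one_add_meanHessianNorm hr hL hL0 hα t p hNin
    have houter : ∀ χ : Fin Nin → a.Data, ∫⁻ χ' : Fin Nout → a.Data,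
        ENNReal.ofReal ‖a.sampleMetaGradient α (t, χ, χ') p‖ ∂(Measure.pi fun _ => a.dataLaw t)
        ≤ ENNReal.ofReal ((1 + α * a.meanHessianNorm t p χ) * B) := by
      intro χ
      obtain ⟨hgi, hg⟩ := integral_norm_batchGradient_le hr hB t
        (p - α • gradient (a.batchLoss t χ) p) hNout
      have hb : ∀ χ' : Fin Nout → a.Data, ‖a.sampleMetaGradient α (t, χ, χ') p‖
          ≤ (1 + α * a.meanHessianNorm t p χ)
            * ‖gradient (a.batchLoss t χ') (p - α • gradient (a.batchLoss t χ) p)‖ := fun χ' =>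
        ContinuousLinearMap.le_of_opNorm_le _ (norm_id_sub_batchHessian_le hr hα t p χ) _
      refine (lintegral_mono fun χ' => ENNReal.ofReal_le_ofReal (hb χ')).trans ?_
      refine lintegral_ofReal_le_of_integral_le
        (fun χ' => mul_nonneg (hpt t χ) (norm_nonneg _)) (hgi.const_mul _) ?_
      rw [integral_const_mul]
      exact mul_le_mul_of_nonneg_left hg (hpt t χ)
    refine (lintegral_mono houter).trans ?_
    refine lintegral_ofReal_le_of_integral_le (fun χ => mul_nonneg (hpt t χ) hB0)
      (h1i.mul_const B) ?_
    rw [integral_mul_const]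
    exact mul_le_mul_of_nonneg_right h1 hB0
  refine (lintegral_mono htask).trans (le_of_eq ?_)
  simp

include hr hL hL0 hB hN hT hα in
/-- The second moment of the stochastic MAML gradient. -/
theorem integral_norm_stochasticMetaGradient_sq_le (p : Param M) {Nin Nout S : ℕ}
    (hNin : 0 < Nin) (hNout : 0 < Nout) (hS : 0 < S) :
    Integrable (fun s : Fin S → a.Sample Nin Nout => ‖a.stochasticMetaGradient α s p‖ ^ 2)
      (Measure.pi fun _ => a.sampleLaw Nin Nout) ∧
    ∫ s : Fin S → a.Sample Nin Nout, ‖a.stochasticMetaGradient α s p‖ ^ 2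
      ∂(Measure.pi fun _ => a.sampleLaw Nin Nout)
      ≤ Bhat α L B ^ 2 + 3 / (S : ℝ) * (C1sq α L B σG σH Nin Nout + C2sq α L B γG γH) := by
  obtain ⟨hm, hle⟩ := integral_norm_sampleMetaGradient_sub_sq_le hr hL hL0 hB hN hT hα p hNin hNout
  have hav := memLp_average_pi hm S
  refine ⟨(memLp_two_iff_integrable_sq_norm hav.1).1 hav, ?_⟩
  -- The exact MAML gradient of the mean risk need not be the mean of the samples; any centre bounds
  -- the variance from above.
  refine (integral_norm_average_sq_pi_le hm (metaGradient α a.meanRisk p) hS).trans ?_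
  have h1 : ‖∫ s : a.Sample Nin Nout, a.sampleMetaGradient α s p ∂(a.sampleLaw Nin Nout)‖
      ≤ Bhat α L B := (norm_integral_le_integral_norm _).trans
    (integral_norm_sampleMetaGradient_le hr hL hL0 hB hα p hNin hNout)
  rw [div_mul_eq_mul_div]
  gcongr

end SampleBound

end Agent

/-! ### Contraction of the disagreement in one step -/

section NetworkContraction

variable {K M : ℕ}

/-- The matrix mixes agents and acts identically on each of the `M` coordinates, so the operator
bound on `ℝ^K` is summed over coordinates. -/
theorem sum_norm_sum_smul_sq_le (V : Matrix (Fin K) (Fin K) ℝ) (x : Fin K → Param M) :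
    ∑ k, ‖∑ l, V k l • x l‖ ^ 2
      ≤ ‖Matrix.toEuclideanCLM (n := Fin K) (𝕜 := ℝ) V‖ ^ 2 * ∑ k, ‖x k‖ ^ 2 := by
  simp only [EuclideanSpace.norm_sq_eq]
  rw [Finset.sum_comm, Finset.sum_comm (s := Finset.univ (α := Fin K)), Finset.mul_sum]
  refine Finset.sum_le_sum fun m _ => ?_
  set y : EuclideanSpace ℝ (Fin K) := WithLp.toLp 2 fun l => x l m with hy
  have h := pow_le_pow_left₀ (norm_nonneg _)
    ((Matrix.toEuclideanCLM (n := Fin K) (𝕜 := ℝ) V).le_opNorm y) 2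
  rw [mul_pow, EuclideanSpace.norm_sq_eq, EuclideanSpace.norm_sq_eq] at h
  refine le_trans (le_of_eq ?_) h
  refine Finset.sum_congr rfl fun k _ => ?_
  congr 2
  simp [hy, Matrix.mulVec, dotProduct]

/-- Unit row sums of `A` keep the centroid unchanged by the combination, and unit column sums make
the deviation matrix kill constants. The free vector `c` is later the old centroid, which exposes
the old disagreement. -/
theorem combine_sub_centroid (hK : 0 < K) {A : Matrix (Fin K) (Fin K) ℝ}
    (hA : A ∈ doublyStochastic ℝ (Fin K)) (x : Fin K → Param M) (c : Param M) (k : Fin K) :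
    ∑ l, A l k • x l - centroid (fun k => ∑ l, A l k • x l)
      = ∑ l, deviationMatrix A k l • (x l - c) := by
  have hK' : (K : ℝ) ≠ 0 := by exact_mod_cast hK.ne'
  have h1 : centroid (fun k => ∑ l, A l k • x l) = (1 / (K : ℝ)) • ∑ l, x l := by
    rw [centroid, Finset.sum_comm]
    congr 1
    refine Finset.sum_congr rfl fun l _ => ?_
    rw [← Finset.sum_smul, sum_row_of_mem_doublyStochastic hA, one_smul]
  have h2 : ∑ l, deviationMatrix A k l • c = 0 := by
    rw [← Finset.sum_smul]
    simp only [deviationMatrix, Matrix.sub_apply, Matrix.transpose_apply, Matrix.of_apply,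
      Finset.sum_sub_distrib, sum_col_of_mem_doublyStochastic hA]
    simp [hK']
  simp only [smul_sub, Finset.sum_sub_distrib]
  rw [h2, sub_zero, h1, Finset.smul_sum, ← Finset.sum_sub_distrib]
  refine Finset.sum_congr rfl fun l _ => ?_
  simp [deviationMatrix, sub_smul]

theorem mixingRate_nonneg (A : Matrix (Fin K) (Fin K) ℝ) : 0 ≤ mixingRate A := norm_nonneg _

theorem sum_norm_combine_sub_centroid_sq_le (hK : 0 < K) {A : Matrix (Fin K) (Fin K) ℝ}
    (hA : A ∈ doublyStochastic ℝ (Fin K)) (hlt : mixingRate A < 1) (p g : Fin K → Param M)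
    (μ : ℝ) :
    ∑ k, ‖∑ l, A l k • (p l - μ • g l)
        - centroid (fun k => ∑ l, A l k • (p l - μ • g l))‖ ^ 2
      ≤ mixingRate A * ∑ k, ‖p k - centroid p‖ ^ 2
        + μ ^ 2 * (mixingRate A ^ 2 / (1 - mixingRate A)) * ∑ k, ‖g k‖ ^ 2 := by
  set lam := mixingRate A with hlam
  have h0 : 0 ≤ lam := mixingRate_nonneg A
  have h1 : 0 < 1 - lam := by linarith
  simp only [combine_sub_centroid hK hA _ (centroid p)]
  refine (sum_norm_sum_smul_sq_le _ _).trans ?_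
  change lam ^ 2 * _ ≤ _
  rw [Finset.mul_sum, Finset.mul_sum, Finset.mul_sum, ← Finset.sum_add_distrib]
  refine Finset.sum_le_sum fun k _ => ?_
  have hn : ‖p k - μ • g k - centroid p‖ ≤ ‖p k - centroid p‖ + |μ| * ‖g k‖ := by
    rw [sub_right_comm]
    refine (norm_sub_le _ _).trans ?_
    rw [norm_smul, Real.norm_eq_abs]
  set x := ‖p k - centroid p‖ with hx
  set y := ‖g k‖ with hy
  calc lam ^ 2 * ‖p k - μ • g k - centroid p‖ ^ 2 ≤ lam ^ 2 * (x + |μ| * y) ^ 2 := by gcongr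
    _ = (lam ^ 2 * (x + |μ| * y) ^ 2 * (1 - lam)) / (1 - lam) := by field_simp
    _ ≤ (lam * x ^ 2 * (1 - lam) + μ ^ 2 * lam ^ 2 * y ^ 2) / (1 - lam) := by
        gcongr
        rw [← sq_abs μ]
        -- Convexity with weights `lam` and `1 - lam`, cleared of denominators: the gap is exactly
        -- `lam * ((1 - lam) * x - lam * (|μ| * y)) ^ 2`. This form also covers `lam = 0`.
        nlinarith [mul_nonneg h0 (sq_nonneg ((1 - lam) * x - lam * (|μ| * y)))]
    _ = _ := by field_simp

end NetworkContraction

/-! ### Independence from the past and the mean-square recursion -/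

section Iterates

variable {K M : ℕ} {agent : Fin K → Agent.{u, v} M} {Nin Nout : ℕ} {S : Fin K → ℕ}
  {A : Matrix (Fin K) (Fin K) ℝ} {α μ : ℝ} {w₀ : Fin K → Param M}
  {Ω : Type w} [mΩ : MeasurableSpace Ω] {P : Measure Ω} [IsProbabilityMeasure P]
  {ξ : ℕ → Ω → ∀ k, Fin (S k) → (agent k).Sample Nin Nout}

theorem measurable_iterate_step (hreg : ∀ k, (agent k).Regular)
    (A : Matrix (Fin K) (Fin K) ℝ) (α μ : ℝ) :
    Measurable fun q : (Fin K → Param M) × (∀ k, Fin (S k) → (agent k).Sample Nin Nout) =>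
      fun k => ∑ l, A l k • (q.1 l - μ • (agent l).stochasticMetaGradient α (q.2 l) (q.1 l)) := by
  refine measurable_pi_lambda _ fun k => Finset.measurable_sum _ fun l _ => ?_
  have h1 := ((hreg l).measurable_stochasticMetaGradient (Nin := Nin) (Nout := Nout)
    (S := S l) α).comp
    (f := fun q : (Fin K → Param M) × (∀ k, Fin (S k) → (agent k).Sample Nin Nout) =>
      (q.2 l, q.1 l)) (by fun_prop)
  have h2 : Measurable fun q : (Fin K → Param M) ×
      (∀ k, Fin (S k) → (agent k).Sample Nin Nout) => q.1 l := by fun_prop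
  exact (h2.sub (h1.const_smul μ)).const_smul (A l k)

omit mΩ in
-- Time `i` uses only the samples with index below `i`, because `ξ i` drives the step from `i` to `i
-- + 1`. Joint independence of the samples then separates the iterate from `ξ i`.
theorem measurable_iterates_past (hreg : ∀ k, (agent k).Regular)
    (ξ : ℕ → Ω → ∀ k, Fin (S k) → (agent k).Sample Nin Nout) (i : ℕ) :
    Measurable[⨆ j ∈ {j : ℕ | j < i}, MeasurableSpace.comap (ξ j) inferInstance]
      fun ω => iterates agent A α μ w₀ (fun j => ξ j ω) i := by
  induction i with
  | zero => exact measurable_const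
  | succ i ih =>
    have h1 : Measurable[⨆ j ∈ {j : ℕ | j < i + 1}, MeasurableSpace.comap (ξ j) inferInstance]
        fun ω => iterates agent A α μ w₀ (fun j => ξ j ω) i :=
      ih.mono (biSup_mono fun j (hj : j < i) => Nat.lt_succ_of_lt hj) le_rfl
    have h2 : Measurable[⨆ j ∈ {j : ℕ | j < i + 1}, MeasurableSpace.comap (ξ j) inferInstance]
        (ξ i) := by
      refine Measurable.mono (comap_measurable (ξ i)) ?_ le_rfl
      exact le_biSup (fun j => MeasurableSpace.comap (ξ j) inferInstance) (Nat.lt_succ_self i)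
    have h3 := h1.prodMk h2
    have h4 := (measurable_iterate_step (Nin := Nin) (Nout := Nout) (S := S) hreg A α μ).comp h3
    simp only [iterates]
    exact h4

omit [IsProbabilityMeasure P] in
theorem IsSampling.measurable_iterates (hs : IsSampling P agent Nin Nout S ξ)
    (hreg : ∀ k, (agent k).Regular) (i : ℕ) :
    Measurable fun ω => iterates agent A α μ w₀ (fun j => ξ j ω) i :=
  (measurable_iterates_past hreg ξ i).mono
    (iSup₂_le fun j _ => (hs.measurable j).comap_le) le_rfl

omit [IsProbabilityMeasure P] in
theorem IsSampling.indepFun_iterates (hs : IsSampling P agent Nin Nout S ξ)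
    (hreg : ∀ k, (agent k).Regular) (i : ℕ) :
    IndepFun (fun ω => iterates agent A α μ w₀ (fun j => ξ j ω) i) (ξ i) P := by
  have h := indep_iSup_of_disjoint (fun j => (hs.measurable j).comap_le) hs.indep
    (S := {j : ℕ | j < i}) (T := {i}) (by simp)
  rw [IndepFun_iff_Indep]
  refine indep_of_indep_of_le_left (indep_of_indep_of_le_right h ?_)
    (measurable_iterates_past hreg ξ i).comap_le
  simp

/-- The current iterate and the fresh sample have a product joint law, so a bound uniform over fixed
parameters can be integrated against the law of the iterate. -/
theorem IsSampling.integral_norm_gradient_sq_le (hs : IsSampling P agent Nin Nout S ξ)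
    (hreg : ∀ k, (agent k).Regular) {G : ℝ} (hG0 : 0 ≤ G) (k : Fin K)
    (hG : ∀ p, Integrable (fun s : Fin (S k) → (agent k).Sample Nin Nout =>
        ‖(agent k).stochasticMetaGradient α s p‖ ^ 2)
        (Measure.pi fun _ => (agent k).sampleLaw Nin Nout) ∧
      ∫ s : Fin (S k) → (agent k).Sample Nin Nout, ‖(agent k).stochasticMetaGradient α s p‖ ^ 2
        ∂(Measure.pi fun _ => (agent k).sampleLaw Nin Nout) ≤ G) (i : ℕ) :
    Integrable (fun ω => ‖(agent k).stochasticMetaGradient α (ξ i ω k)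
      (iterates agent A α μ w₀ (fun j => ξ j ω) i k)‖ ^ 2) P ∧
    ∫ ω, ‖(agent k).stochasticMetaGradient α (ξ i ω k)
      (iterates agent A α μ w₀ (fun j => ξ j ω) i k)‖ ^ 2 ∂P ≤ G := by
  have hW : Measurable fun ω => iterates agent A α μ w₀ (fun j => ξ j ω) i k :=
    (measurable_pi_apply k).comp (hs.measurable_iterates hreg i)
  have hξ : Measurable fun ω => ξ i ω k := (measurable_pi_apply k).comp (hs.measurable i)
  have hind : IndepFun (fun ω => iterates agent A α μ w₀ (fun j => ξ j ω) i k)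
      (fun ω => ξ i ω k) P :=
    (hs.indepFun_iterates hreg i).comp (measurable_pi_apply k) (measurable_pi_apply k)
  have hmap := (indepFun_iff_map_prod_eq_prod_map_map hW.aemeasurable hξ.aemeasurable).1 hind
  rw [hs.law i k] at hmap
  have hF : Measurable fun q : Param M × (Fin (S k) → (agent k).Sample Nin Nout) =>
      ‖(agent k).stochasticMetaGradient α q.2 q.1‖ ^ 2 :=
    (((hreg k).measurable_stochasticMetaGradient α).comp measurable_swap).norm.pow_const 2
  refine integral_le_of_lintegral_ofReal_le (fun ω => by positivity)
    (hF.comp (hW.prodMk hξ)).aestronglyMeasurable hG0 ?_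
  have h1 := lintegral_map (μ := P) hF.ennreal_ofReal (hW.prodMk hξ)
  have : IsProbabilityMeasure (P.map fun ω => iterates agent A α μ w₀ (fun j => ξ j ω) i k) :=
    Measure.isProbabilityMeasure_map hW.aemeasurable
  rw [hmap, lintegral_prod _ hF.ennreal_ofReal.aemeasurable] at h1
  rw [← h1]
  refine (lintegral_mono fun p => lintegral_ofReal_le_of_integral_le
    (fun s => by positivity) (hG p).1 (hG p).2).trans (le_of_eq ?_)
  simp

theorem IsSampling.disagreement_recursion (hs : IsSampling P agent Nin Nout S ξ) (hK : 0 < K)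
    (hreg : ∀ k, (agent k).Regular) (hA : A ∈ doublyStochastic ℝ (Fin K))
    (hlt : mixingRate A < 1) {G : ℝ} (hG0 : 0 ≤ G)
    (hG : ∀ k p, Integrable (fun s : Fin (S k) → (agent k).Sample Nin Nout =>
        ‖(agent k).stochasticMetaGradient α s p‖ ^ 2)
        (Measure.pi fun _ => (agent k).sampleLaw Nin Nout) ∧
      ∫ s : Fin (S k) → (agent k).Sample Nin Nout, ‖(agent k).stochasticMetaGradient α s p‖ ^ 2
        ∂(Measure.pi fun _ => (agent k).sampleLaw Nin Nout) ≤ G) (i : ℕ) :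
    (∀ k, Integrable (fun ω => ‖iterates agent A α μ w₀ (fun j => ξ j ω) i k
      - centroid (iterates agent A α μ w₀ (fun j => ξ j ω) i)‖ ^ 2) P) ∧
    (1 / (K : ℝ)) * ∑ k, ∫ ω, ‖iterates agent A α μ w₀ (fun j => ξ j ω) i k
      - centroid (iterates agent A α μ w₀ (fun j => ξ j ω) i)‖ ^ 2 ∂P
      ≤ mixingRate A ^ i * ((1 / (K : ℝ)) * ∑ k, ‖w₀ k - centroid w₀‖ ^ 2)
        + μ ^ 2 * (mixingRate A ^ 2 / (1 - mixingRate A) ^ 2) * G := by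
  have h0 := mixingRate_nonneg A
  have h1 : 0 < 1 - mixingRate A := by linarith
  have hK' : (0 : ℝ) < K := by exact_mod_cast hK
  induction i with
  | zero =>
    simp only [iterates]
    refine ⟨fun k => integrable_const _, ?_⟩
    simp only [integral_const, probReal_univ, one_smul, pow_zero, one_mul]
    have : 0 ≤ μ ^ 2 * (mixingRate A ^ 2 / (1 - mixingRate A) ^ 2) * G := by positivity
    linarith
  | succ i ih =>
    obtain ⟨ihi, ihle⟩ := ih
    set W : ℕ → Ω → Fin K → Param M := fun i ω => iterates agent A α μ w₀ (fun j => ξ j ω) i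
      with hWdef
    set g : Ω → Fin K → Param M := fun ω k =>
      (agent k).stochasticMetaGradient α (ξ i ω k) (W i ω k) with hgdef
    have hg : ∀ k, Integrable (fun ω => ‖g ω k‖ ^ 2) P ∧ ∫ ω, ‖g ω k‖ ^ 2 ∂P ≤ G := fun k =>
      hs.integral_norm_gradient_sq_le hreg hG0 k (hG k) i
    set b := μ ^ 2 * (mixingRate A ^ 2 / (1 - mixingRate A)) with hb
    have hb0 : 0 ≤ b := by positivity
    have hstep : ∀ ω, ∑ k, ‖W (i + 1) ω k - centroid (W (i + 1) ω)‖ ^ 2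
        ≤ mixingRate A * ∑ k, ‖W i ω k - centroid (W i ω)‖ ^ 2 + b * ∑ k, ‖g ω k‖ ^ 2 := fun ω =>
      sum_norm_combine_sub_centroid_sq_le hK hA hlt (W i ω) (g ω) μ
    have j1 := (integrable_finsetSum Finset.univ fun k _ => ihi k).const_mul (mixingRate A)
    have j2 := (integrable_finsetSum Finset.univ fun k _ => (hg k).1).const_mul b
    have hmeas : Measurable (W (i + 1)) := hs.measurable_iterates hreg (i + 1)
    have hmk : ∀ k, Measurable fun ω => W (i + 1) ω k := fun k =>
      (measurable_pi_apply k).comp hmeas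
    have hmc : Measurable fun ω => centroid (W (i + 1) ω) :=
      (Finset.measurable_fun_sum Finset.univ fun k _ => hmk k).const_smul (1 / (K : ℝ))
    -- Integrability is part of the induction: the one-step inequality itself dominates the new
    -- disagreement by integrable quantities.
    have hint : ∀ k, Integrable (fun ω => ‖W (i + 1) ω k - centroid (W (i + 1) ω)‖ ^ 2) P := by
      intro k
      refine (j1.add j2).mono' (((hmk k).sub hmc).norm.pow_const 2).aestronglyMeasurable
        (ae_of_all _ fun ω => ?_)
      rw [Real.norm_of_nonneg (by positivity)]
      exact (Finset.single_le_sum (f := fun k => ‖W (i + 1) ω k - centroid (W (i + 1) ω)‖ ^ 2)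
        (fun k _ => by positivity) (Finset.mem_univ k)).trans (hstep ω)
    refine ⟨hint, ?_⟩
    have hmono := integral_mono (integrable_finsetSum Finset.univ fun k _ => hint k)
      (j1.fun_add j2) hstep
    rw [integral_add j1 j2, integral_const_mul, integral_const_mul,
      integral_finsetSum _ fun k _ => hint k, integral_finsetSum _ fun k _ => ihi k,
      integral_finsetSum _ fun k _ => (hg k).1] at hmono
    have hgsum : (1 / (K : ℝ)) * ∑ k, ∫ ω, ‖g ω k‖ ^ 2 ∂P ≤ G := by
      calc (1 / (K : ℝ)) * ∑ k, ∫ ω, ‖g ω k‖ ^ 2 ∂P ≤ (1 / (K : ℝ)) * ∑ _k : Fin K, G := by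
            gcongr with k
            exact (hg k).2
        _ = G := by simp [hK'.ne']
    set E := (1 / (K : ℝ)) * ∑ k, ∫ ω, ‖W i ω k - centroid (W i ω)‖ ^ 2 ∂P with hE
    calc (1 / (K : ℝ)) * ∑ k, ∫ ω, ‖W (i + 1) ω k - centroid (W (i + 1) ω)‖ ^ 2 ∂P
        ≤ (1 / (K : ℝ)) * (mixingRate A * ∑ k, ∫ ω, ‖W i ω k - centroid (W i ω)‖ ^ 2 ∂P
          + b * ∑ k, ∫ ω, ‖g ω k‖ ^ 2 ∂P) := by gcongr
      _ = mixingRate A * E + b * ((1 / (K : ℝ)) * ∑ k, ∫ ω, ‖g ω k‖ ^ 2 ∂P) := by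
          rw [hE]; ring
      _ ≤ mixingRate A * (mixingRate A ^ i * ((1 / (K : ℝ)) * ∑ k, ‖w₀ k - centroid w₀‖ ^ 2)
            + μ ^ 2 * (mixingRate A ^ 2 / (1 - mixingRate A) ^ 2) * G) + b * G := by gcongr
      -- The constant is the fixed point of the recursion: `λ / (1 - λ)² + 1 / (1 - λ) = 1 / (1 -
      -- λ)²`.
      _ = _ := by
          rw [hb]
          field_simp
          ring

end Iterates

/-! ### The number of iterations until the transient is of order `μ³` -/

section Threshold

theorem isBigO_threshold (lam D : ℝ) :
    (fun μ : ℝ => 3 * Real.log μ / Real.log lam + D) =O[𝓝[>] 0] Real.log := by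
  refine Asymptotics.IsBigO.add ?_ ?_
  · have : (fun μ : ℝ => 3 * Real.log μ / Real.log lam)
        = fun μ : ℝ => (3 / Real.log lam) * Real.log μ := by funext μ; ring
    rw [this]
    exact Asymptotics.isBigO_const_mul_self _ _ _
  · refine (Asymptotics.isLittleO_const_left.2 (Or.inr ?_)).isBigO
    exact tendsto_abs_atBot_atTop.comp Real.tendsto_log_nhdsGT_zero

theorem isLittleO_threshold (lam D : ℝ) :
    (fun μ : ℝ => 3 * Real.log μ / Real.log lam + D) =o[𝓝[>] 0] fun μ : ℝ => 1 / μ := by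
  refine (isBigO_threshold lam D).trans_isLittleO ?_
  refine (isLittleO_log_rpow_nhdsGT_zero (r := -1) (by norm_num)).congr_right fun μ => ?_
  rw [Real.rpow_neg_one, one_div]

theorem pow_le_of_threshold_le {lam μ : ℝ} (h0 : 0 ≤ lam) (h1 : lam < 1) (hμ : 0 < μ) {i : ℕ}
    (hi : 3 * Real.log μ / Real.log lam + 1 ≤ (i : ℝ)) : lam ^ i ≤ μ ^ 3 := by
  rcases h0.eq_or_lt with rfl | hpos
  -- For `lam = 0` the quotient is `0` in Lean, and the summand `1` in the threshold excludes `i =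
  -- 0`, where `0 ^ 0 = 1` would break the claim. For `lam > 0` this summand is slack.
  · have : i ≠ 0 := by
      rintro rfl
      norm_num at hi
    rw [zero_pow this]
    positivity
  have hlog : Real.log lam < 0 := Real.log_neg hpos h1
  have h2 : 3 * Real.log μ / Real.log lam ≤ i := by linarith
  rw [div_le_iff_of_neg hlog] at h2
  rw [← Real.log_le_log_iff (by positivity) (by positivity), Real.log_pow, Real.log_pow]
  push_cast
  linarith

end Threshold

/-! ### Assembly -/

theorem le_Csq {K : ℕ} (α L B σG σH γG γH : ℝ) (Nin Nout : ℕ) (S : Fin K → ℕ) (k : Fin K) :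
    3 / (S k : ℝ) * (C1sq α L B σG σH Nin Nout + C2sq α L B γG γH)
      ≤ Csq α L B σG σH γG γH Nin Nout S := by
  refine le_trans ?_ (le_ciSup (f := fun k : Fin K => 3 / (S k : ℝ) *
    (C1sq α L B σG σH Nin Nout + C2sq α L B γG γH + C3 α L B σG σH γG γH Nin ^ 2))
    (Set.finite_range _).bddAbove k)
  exact mul_le_mul_of_nonneg_left (by linarith [sq_nonneg (C3 α L B σG σH γG γH Nin)])
    (by positivity)

end DifMAML

theorem theorem1 {K M : ℕ} (hK : 0 < K)
    (agent : Fin K → DifMAML.Agent.{u, v} M)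
    (A : Matrix (Fin K) (Fin K) ℝ)
    (α L ρ B σG σH γG γH : ℝ) (Nin Nout : ℕ) (S : Fin K → ℕ)
    (w₀ : Fin K → DifMAML.Param M)
    (hα : 0 < α) (hL : 0 ≤ L) (hσG : 0 ≤ σG) (hσH : 0 ≤ σH) (hγG : 0 ≤ γG) (hγH : 0 ≤ γH)
    (hNin : 0 < Nin) (hNout : 0 < Nout) (hS : ∀ k, 0 < S k)
    (hreg : ∀ k, (agent k).Regular)
    (hLipGrad : ∀ k, (agent k).LipschitzGradients L)
    (hLipHess : ∀ k, (agent k).LipschitzHessians ρ)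
    (hBdd : ∀ k, (agent k).BoundedGradients B)
    (hNoise : ∀ k, (agent k).BoundedNoiseMoments σG σH)
    (hTask : ∀ k, (agent k).BoundedTaskVariability γG γH)
    (hDS : A ∈ doublyStochastic ℝ (Fin K)) (hPrim : A.IsPrimitive) :
    -- the spectral radius of `Aᵀ - (1/K) 1 1ᵀ` is smaller than one, and it is the mixing rate
    -- when `A` is normal, in particular when `A` is symmetric
    DifMAML.deviationSpectralRadius A < 1 ∧
    (A * Aᵀ = Aᵀ * A → DifMAML.mixingRate A = DifMAML.deviationSpectralRadius A) ∧
    (DifMAML.mixingRate A < 1 →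
      ∃ c D : ℝ,
        -- the threshold on the number of iterations is `O(log μ)` and `o(1/μ)` as `μ → 0⁺`
        (fun μ : ℝ => 3 * Real.log μ / Real.log (DifMAML.mixingRate A) + D)
          =O[𝓝[>] 0] Real.log ∧
        (fun μ : ℝ => 3 * Real.log μ / Real.log (DifMAML.mixingRate A) + D)
          =o[𝓝[>] 0] (fun μ : ℝ => 1 / μ) ∧
        ∀ μ : ℝ, 0 < μ →
        ∀ (Ω : Type w) [MeasurableSpace Ω] (P : Measure Ω) [IsProbabilityMeasure P]
          (ξ : ℕ → Ω → ∀ k, Fin (S k) → (agent k).Sample Nin Nout),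
          DifMAML.IsSampling P agent Nin Nout S ξ →
        ∀ W : ℕ → Ω → Fin K → DifMAML.Param M,
          (∀ i ω, W i ω = DifMAML.iterates agent A α μ w₀ (fun j => ξ j ω) i) →
        ∀ i : ℕ,
          (∀ k, Integrable (fun ω => ‖W i ω k - DifMAML.centroid (W i ω)‖ ^ 2) P) ∧
          -- the linear rate
          (1 / (K : ℝ)) * ∑ k, ∫ ω, ‖W i ω k - DifMAML.centroid (W i ω)‖ ^ 2 ∂P
            ≤ DifMAML.mixingRate A ^ i
                * ((1 / (K : ℝ)) * ∑ k, ‖w₀ k - DifMAML.centroid w₀‖ ^ 2)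
              + μ ^ 2 * (DifMAML.mixingRate A ^ 2 / (1 - DifMAML.mixingRate A) ^ 2)
                * (DifMAML.Bhat α L B ^ 2 + DifMAML.Csq α L B σG σH γG γH Nin Nout S) ∧
          (3 * Real.log μ / Real.log (DifMAML.mixingRate A) + D ≤ (i : ℝ) →
            (1 / (K : ℝ)) * ∑ k, ∫ ω, ‖W i ω k - DifMAML.centroid (W i ω)‖ ^ 2 ∂P
              ≤ μ ^ 2 * (DifMAML.mixingRate A ^ 2 / (1 - DifMAML.mixingRate A) ^ 2)
                  * (DifMAML.Bhat α L B ^ 2 + DifMAML.Csq α L B σG σH γG γH Nin Nout S)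
                + c * μ ^ 3)) := by
  refine ⟨DifMAML.deviationSpectralRadius_lt_one hK hDS hPrim,
    DifMAML.mixingRate_eq_deviationSpectralRadius hDS, fun hlt => ?_⟩
  -- The constant `c` is the initial disagreement, multiplied by `λ₂ ^ i ≤ μ ^ 3` past the
  -- threshold; `D = 1` serves the case `λ₂ = 0`.
  refine ⟨(1 / (K : ℝ)) * ∑ k, ‖w₀ k - DifMAML.centroid w₀‖ ^ 2, 1,
    DifMAML.isBigO_threshold _ _, DifMAML.isLittleO_threshold _ _, ?_⟩
  intro μ hμ Ω _ P _ ξ hs W hW i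
  have hG : ∀ k p, Integrable (fun s : Fin (S k) → (agent k).Sample Nin Nout =>
        ‖(agent k).stochasticMetaGradient α s p‖ ^ 2)
        (Measure.pi fun _ => (agent k).sampleLaw Nin Nout) ∧
      ∫ s : Fin (S k) → (agent k).Sample Nin Nout, ‖(agent k).stochasticMetaGradient α s p‖ ^ 2
        ∂(Measure.pi fun _ => (agent k).sampleLaw Nin Nout)
        ≤ DifMAML.Bhat α L B ^ 2 + DifMAML.Csq α L B σG σH γG γH Nin Nout S := by
    intro k p
    obtain ⟨h1, h2⟩ := DifMAML.Agent.integral_norm_stochasticMetaGradient_sq_le (hreg k)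
      (hLipGrad k) hL (hBdd k) (hNoise k) (hTask k) hα.le p hNin hNout (hS k)
    exact ⟨h1, h2.trans (add_le_add_right (DifMAML.le_Csq α L B σG σH γG γH Nin Nout S k) _)⟩
  have hG0 : 0 ≤ DifMAML.Bhat α L B ^ 2 + DifMAML.Csq α L B σG σH γG γH Nin Nout S :=
    (integral_nonneg fun _ => by positivity).trans (hG ⟨0, hK⟩ 0).2
  obtain ⟨hint, hle⟩ := hs.disagreement_recursion (α := α) (μ := μ) (w₀ := w₀) hK hreg hDS hlt
    hG0 hG i
  simp only [hW]
  refine ⟨hint, hle, fun hi => hle.trans ?_⟩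
  have hpow := DifMAML.pow_le_of_threshold_le (DifMAML.mixingRate_nonneg A) hlt hμ hi
  have h0 : 0 ≤ (1 / (K : ℝ)) * ∑ k, ‖w₀ k - DifMAML.centroid w₀‖ ^ 2 := by positivity
  linarith [mul_le_mul_of_nonneg_right hpow h0]
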